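/- There are absolute constants $K>0$ and $k\in\mathbb{N}$ such that the following holds for every finite simple graph $G$ on $n$ vertices that is bridgeless (no edge of $G$ is a bridge; for connected $G$ this means that deleting any single edge leaves $G$ connected). For an edge $e$ of $G$ let $C_e$ be a shortest simple cycle of $G$ through $e$, let $|C_e|$ be its number of edges, and let $\mathrm{OPT}(G)=\max_{e\in E(G)}|C_e|$ (and $\mathrm{OPT}(G)=0$ if $G$ has no edges). Then there is a collection $\mathcal{C}$ of simple cycles of $G$ such that 1. (dilation $\widetilde{O}(\mathrm{OPT}(G))$) every cycle of $\mathcal{C}$ has length at most $K(\log n)^k\cdot\mathrm{OPT}(G)$; 2. (cover with congestion $\widetilde{O}(1)$) every edge of $G$ lies on at least one and at most $K(\log n)^k$ cycles of $\mathcal{C}$; 3. (length $\widetilde{O}(|C_e|)$) every edge $e$ of $G$ lies on a cycle $C'_e\in\mathcal{C}$ with $|C'_e|\le K(\log n)^k\cdot|C_e|$. -/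

import Mathlib

namespace CycleCover

variable {V : Type*}

/-- A graph is bridgeless if none of its edges is a bridge, i.e. deleting a single edge never
disconnects its two ends. For a connected graph this says that deleting any single edge leaves
the graph connected. -/
def Bridgeless (G : SimpleGraph V) : Prop :=
  ∀ e ∈ G.edgeSet, ¬ G.IsBridge e

/-- `C` is the edge set of a (simple) cycle of `G`. The length of the cycle is `C.card`. -/
def IsCycleOf (G : SimpleGraph V) (C : Finset (Sym2 V)) : Prop :=
  ∃ (v : V) (p : G.Walk v v), p.IsCycle ∧ ∀ e, e ∈ C ↔ e ∈ p.edges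

open Classical in
/-- The number of cycles of the collection `𝒞` that go through the edge `e`. -/
noncomputable def congestion (𝒞 : Finset (Finset (Sym2 V))) (e : Sym2 V) : ℕ :=
  (𝒞.filter (fun C => e ∈ C)).card

/-- `𝒞` is a `(d, c)`-cycle cover of `G`: a collection of cycles of `G`, each of length at most
`d`, such that every edge of `G` lies on at least one and at most `c` of the cycles. -/
structure IsCycleCover (G : SimpleGraph V) (d c : ℝ) (𝒞 : Finset (Finset (Sym2 V))) : Prop where
  isCycle : ∀ C ∈ 𝒞, IsCycleOf G C
  dilation_le : ∀ C ∈ 𝒞, (C.card : ℝ) ≤ d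
  covers : ∀ e ∈ G.edgeSet, ∃ C ∈ 𝒞, e ∈ C
  congestion_le : ∀ e ∈ G.edgeSet, (congestion 𝒞 e : ℝ) ≤ c

/-- `|C_e|`: the length of a shortest cycle of `G` through the edge `e`. It is meaningful when `e`
lies on a cycle; see `exists_shortest_cycle` for bridgeless graphs. -/
noncomputable def shortestCycleLength (G : SimpleGraph V) (e : Sym2 V) : ℕ :=
  sInf {l : ℕ | ∃ C : Finset (Sym2 V), IsCycleOf G C ∧ e ∈ C ∧ C.card = l}

/-- `OPT(G)` for a finite graph `G`: the maximum over the edges `e` of `G` of the length of a shortest cycle through `e`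
(`0` if `G` has no edge). -/
noncomputable def optCycleLength (G : SimpleGraph V) : ℕ :=
  ⨆ e : G.edgeSet, shortestCycleLength G e.1

/-- In a bridgeless graph the minimum that defines `|C_e|` is attained, for every edge `e`. -/
theorem exists_shortest_cycle {G : SimpleGraph V} (hG : Bridgeless G) {e : Sym2 V}
    (he : e ∈ G.edgeSet) :
    ∃ C : Finset (Sym2 V), IsCycleOf G C ∧ e ∈ C ∧ C.card = shortestCycleLength G e := by
  classical
  have hne : {l : ℕ | ∃ C : Finset (Sym2 V), IsCycleOf G C ∧ e ∈ C ∧ C.card = l}.Nonempty := by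
    have h := hG e he
    rw [SimpleGraph.isBridge_iff_forall_cycle_notMem he] at h
    push Not at h
    obtain ⟨v, p, hp, hep⟩ := h
    exact ⟨_, p.edges.toFinset, ⟨v, p, hp, fun e => by simp⟩, by simpa using hep, rfl⟩
  exact Nat.sInf_mem hne

/-- `OPT(G)` is a lower bound for the dilation of every cycle cover of `G`, whatever its
congestion. -/
theorem optCycleLength_le_dilation {G : SimpleGraph V} {d : ℕ} {c : ℝ}
    {𝒞 : Finset (Finset (Sym2 V))} (h : IsCycleCover G d c 𝒞) : optCycleLength G ≤ d := by
  refine ciSup_le' fun e => ?_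
  obtain ⟨C, hC, heC⟩ := h.covers e.1 e.2
  have h1 : shortestCycleLength G e.1 ≤ C.card := Nat.sInf_le ⟨C, h.isCycle C hC, heC, rfl⟩
  have h2 : C.card ≤ d := by exact_mod_cast h.dilation_le C hC
  exact h1.trans h2

end CycleCover

/-! Edges are sorted into dyadic classes by $|C_e|$. There are logarithmically many classes, so it
suffices to treat one: cover all edges that lie on cycles of length at most $D$ by cycles of length
$\widetilde O(D)$ with congestion $\widetilde O(1)$. The work takes place in the cycle space over
`ZMod 2`. Its elements are split into edge-disjoint cycles only at the end
(`exists_cycle_decomposition`), which increases neither length nor congestion.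

Region growing (`exists_half_closedFamily`) reduces one class to pieces of radius $O(D\log n)$. Some
ball gains at most a factor two in edges when its radius grows by $2D$; the edges in its core are
covered inside the ball, those with a short cycle outside are left to recursion, and the rest is at
most as large as the core. Half of the edges are served, and logarithmically many repetitions
finish.

In a piece of small radius (`exists_closedFamily_of_radius`) a breadth-first tree is fixed and the
non-tree edges become chords. The sum of the fundamental cycles of a chord set $H$ uses the tree
edge above $v$ exactly when $H$ has an odd number of ends below $v$. In preorder the subtrees are
laminar intervals, so what is needed (`exists_sparse_cover`) is a family of small chord sets such
that each crossed interval is odd on at least one of them and on few.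

"Few" comes from `exists_closing_partition`: contract blocks of 16 consecutive chord ends and take
short even sets of the resulting dense multigraph. Such a set is even on every interval unless it
has an end in one of the at most two blocks that the interval splits.

For "at least one", chords are grouped by the dyadic midpoint that they cross. An interval that
separates both the left ends and the right ends contains the midpoint; such intervals form a chain,
and a minimal cover by single chords works. Otherwise the ends on one side do not matter: a chord
set odd on half of the intervals is paired up along the other side, exactly one pair is then odd,
and closing up the pairs cannot cancel it (`exists_half_cover_of_const`). -/

namespace CycleCover

open Finset

/-! ### Short even edge sets in dense multigraphs -/

theorem zmod_two_add_self (x : ZMod 2) : x + x = 0 := CharTwo.add_self_eq_zero x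

theorem sum_symmDiff_zmod_two {α : Type*} [DecidableEq α] (A B : Finset α) (f : α → ZMod 2) :
    ∑ i ∈ symmDiff A B, f i = ∑ i ∈ A, f i + ∑ i ∈ B, f i := by
  have h1 : ∑ i ∈ symmDiff A B, f i = ∑ i ∈ A \ B, f i + ∑ i ∈ B \ A, f i := by
    rw [symmDiff_def, Finset.sup_eq_union, Finset.sum_union]
    exact disjoint_sdiff_sdiff
  have h2 := Finset.sum_inter_add_sum_sdiff A B f
  have h3 := Finset.sum_inter_add_sum_sdiff B A f
  rw [Finset.inter_comm] at h3
  rw [h1, ← h2, ← h3]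
  have := zmod_two_add_self (∑ i ∈ A ∩ B, f i)
  linear_combination -this

/-- One step of breadth-first growth of a node set in a multigraph. -/
def growBall {α β : Type*} [DecidableEq β] (s t : α → β) (N : Finset β) (E : Finset α)
    (v : β) : ℕ → Finset β
  | 0 => {v}
  | r + 1 => growBall s t N E v r ∪ N.filter (fun x => ∃ i ∈ E,
      (s i = x ∧ t i ∈ growBall s t N E v r) ∨ (t i = x ∧ s i ∈ growBall s t N E v r))

/-- Breadth-first search: each new node brings one edge to the previous ball. That `P` joins `x` to
`v` is stated by testing its boundary against all `g`, which keeps the argument linear and tolerates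
loops and parallel edges. -/
theorem growBall_tree {α β : Type*} [Nonempty α] [DecidableEq α] [DecidableEq β] (s t : α → β)
    (N : Finset β) (E : Finset α) (v : β) (r : ℕ) :
    ∃ τ ⊆ E, τ.card + 1 ≤ (growBall s t N E v r).card ∧
      ∀ x ∈ growBall s t N E v r, ∃ P ⊆ τ, P.card ≤ r ∧
        ∀ g : β → ZMod 2, ∑ i ∈ P, (g (s i) + g (t i)) = g x + g v := by
  induction r with
  | zero =>
    refine ⟨∅, by simp, by simp [growBall], fun x hx => ⟨∅, by simp, by simp, fun g => ?_⟩⟩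
    simp only [growBall, Finset.mem_singleton] at hx
    simp [hx, zmod_two_add_self]
  | succ r ih =>
    obtain ⟨τ, hτ, hc, hP⟩ := ih
    set S := growBall s t N E v r with hS
    set S' := growBall s t N E v (r + 1) with hS'
    have hsub : S ⊆ S' := by rw [hS', growBall]; exact Finset.subset_union_left
    have hnew : ∀ x ∈ S' \ S, ∃ i ∈ E, (s i = x ∧ t i ∈ S) ∨ (t i = x ∧ s i ∈ S) := by
      intro x hx
      rw [Finset.mem_sdiff, hS', growBall, Finset.mem_union, Finset.mem_filter] at hx
      rcases hx.1 with h | h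
      · exact absurd h hx.2
      · exact h.2
    choose! w hwE hw using hnew
    refine ⟨τ ∪ (S' \ S).image w, ?_, ?_, ?_⟩
    · intro i hi
      rcases Finset.mem_union.1 hi with h | h
      · exact hτ h
      · obtain ⟨x, hx, rfl⟩ := Finset.mem_image.1 h
        exact hwE x hx
    · have h1 := Finset.card_union_le τ ((S' \ S).image w)
      have h2 : ((S' \ S).image w).card ≤ (S' \ S).card := Finset.card_image_le
      have h3 := Finset.card_sdiff_add_card_eq_card hsub
      omega
    · intro x hx
      by_cases hxS : x ∈ S
      · obtain ⟨P, h1, h2, h3⟩ := hP x hxS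
        exact ⟨P, h1.trans Finset.subset_union_left, by omega, h3⟩
      · have hx' : x ∈ S' \ S := Finset.mem_sdiff.2 ⟨hx, hxS⟩
        obtain ⟨y, hy, hxy⟩ : ∃ y ∈ S, ∀ g : β → ZMod 2,
            g (s (w x)) + g (t (w x)) = g x + g y := by
          rcases hw x hx' with ⟨h1, h2⟩ | ⟨h1, h2⟩
          · exact ⟨_, h2, fun g => by rw [h1]⟩
          · exact ⟨_, h2, fun g => by rw [h1, add_comm]⟩
        obtain ⟨P, h1, h2, h3⟩ := hP y hy
        refine ⟨symmDiff P {w x}, ?_, ?_, fun g => ?_⟩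
        · refine (Finset.symmDiff_subset_union).trans (Finset.union_subset_union h1 ?_)
          simpa using ⟨x, Finset.mem_sdiff.1 hx', rfl⟩
        · have h4 := Finset.card_le_card (Finset.symmDiff_subset_union (s := P) (t := {w x}))
          have h5 := Finset.card_union_le P {w x}
          simp only [Finset.card_singleton] at h5
          omega
        · rw [sum_symmDiff_zmod_two, h3, Finset.sum_singleton, hxy]
          have := zmod_two_add_self (g y)
          linear_combination this

/-- A multigraph with more than twice as many edges as nodes has a nonempty even edge set of
logarithmic size. -/
theorem exists_short_even_set {α β : Type*} [DecidableEq α] [DecidableEq β] (s t : α → β) (k : ℕ)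
    (N : Finset β) : ∀ (E : Finset α), (∀ i ∈ E, s i ∈ N ∧ t i ∈ N) → N.card < 2 ^ k →
      2 * N.card < E.card → ∃ H ⊆ E, H.Nonempty ∧ H.card ≤ 2 * k + 1 ∧
        ∀ g : β → ZMod 2, ∑ i ∈ H, (g (s i) + g (t i)) = 0 := by
  induction N using Finset.strongInduction with
  | H N ih =>
  intro E hE hk hcard
  by_contra hno
  obtain ⟨i₀, hi₀⟩ : E.Nonempty := Finset.card_pos.1 (by omega)
  have : Nonempty α := ⟨i₀⟩
  set v := s i₀
  set S := growBall s t N E v with hS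
  have hSN : ∀ r, S r ⊆ N := by
    intro r
    induction r with
    | zero => simpa [hS, growBall] using (hE i₀ hi₀).1
    | succ r ihr =>
      rw [hS, growBall]
      exact Finset.union_subset ihr (Finset.filter_subset _ _)
  have hvS : ∀ r, v ∈ S r := by
    intro r
    induction r with
    | zero => simp [hS, growBall]
    | succ r ihr => rw [hS, growBall]; exact Finset.mem_union_left _ ihr
  -- An edge inside the ball but outside the tree would close an even set with at most `2 * r + 1`
  -- edges, so only tree edges remain.
  have hinside : ∀ r ≤ k, (E.filter (fun i => s i ∈ S r ∧ t i ∈ S r)).card + 1 ≤ (S r).card := by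
    intro r hr
    obtain ⟨τ, hτ, hc, hP⟩ := growBall_tree s t N E v r
    refine le_trans (Nat.succ_le_succ (Finset.card_le_card ?_)) hc
    intro i hi
    rw [Finset.mem_filter] at hi
    by_contra hiτ
    obtain ⟨P, h1, h2, h3⟩ := hP _ hi.2.1
    obtain ⟨Q, g1, g2, g3⟩ := hP _ hi.2.2
    have hi1 : i ∉ symmDiff P Q := fun h =>
      hiτ ((Finset.union_subset h1 g1) (Finset.symmDiff_subset_union h))
    apply hno
    refine ⟨insert i (symmDiff P Q), ?_, Finset.insert_nonempty _ _, ?_, fun g => ?_⟩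
    · exact Finset.insert_subset hi.1
        (Finset.symmDiff_subset_union.trans ((Finset.union_subset h1 g1).trans hτ))
    · rw [Finset.card_insert_of_notMem hi1]
      have h4 := Finset.card_le_card (Finset.symmDiff_subset_union (s := P) (t := Q))
      have h5 := Finset.card_union_le P Q
      omega
    · rw [Finset.sum_insert hi1, sum_symmDiff_zmod_two, h3, g3]
      have e1 := zmod_two_add_self (g (s i))
      have e2 := zmod_two_add_self (g (t i))
      have e3 := zmod_two_add_self (g v)
      linear_combination e1 + e2 + e3
  have hstep : ∀ r, (E.filter (fun i => s i ∈ S r ∨ t i ∈ S r)) ⊆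
      E.filter (fun i => s i ∈ S (r + 1) ∧ t i ∈ S (r + 1)) := by
    intro r i hi
    rw [Finset.mem_filter] at hi ⊢
    refine ⟨hi.1, ?_, ?_⟩ <;> rw [hS, growBall, Finset.mem_union, Finset.mem_filter]
    · rcases hi.2 with h | h
      · exact Or.inl h
      · exact Or.inr ⟨(hE i hi.1).1, i, hi.1, Or.inl ⟨rfl, h⟩⟩
    · rcases hi.2 with h | h
      · exact Or.inr ⟨(hE i hi.1).2, i, hi.1, Or.inr ⟨rfl, h⟩⟩
      · exact Or.inl h
  -- If more than `2 * (S r).card` edges touched every ball, then by `hinside` the balls would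
  -- double `k` times and outgrow `N`.
  obtain ⟨r, hr, hinc⟩ : ∃ r < k, (E.filter (fun i => s i ∈ S r ∨ t i ∈ S r)).card ≤
      2 * (S r).card := by
    by_contra! hbig
    have : ∀ r ≤ k, 2 ^ r ≤ (S r).card := by
      intro r
      induction r with
      | zero => intro _; exact Finset.card_pos.2 ⟨v, hvS 0⟩
      | succ r ihr =>
        intro hr
        have h1 := ihr (by omega)
        have h2 := hbig r (by omega)
        have h3 := Finset.card_le_card (hstep r)
        have h4 := hinside (r + 1) hr
        rw [pow_succ]
        omega
    have h1 := this k le_rfl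
    have h2 := Finset.card_le_card (hSN k)
    omega
  have hsplit := Finset.card_filter_add_card_filter_not (s := E)
    (fun i => s i ∈ S r ∨ t i ∈ S r)
  have hN' := Finset.card_sdiff_add_card_eq_card (hSN r)
  have hpos : 0 < (S r).card := Finset.card_pos.2 ⟨v, hvS r⟩
  -- Deleting the ball removes at most two edges per node, so the density hypothesis survives.
  obtain ⟨H, hH, hH'⟩ := ih (N \ S r)
    (Finset.sdiff_ssubset (hSN r) ⟨v, hvS r⟩) (E.filter (fun i => ¬ (s i ∈ S r ∨ t i ∈ S r)))
    (by
      intro i hi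
      rw [Finset.mem_filter, not_or] at hi
      exact ⟨Finset.mem_sdiff.2 ⟨(hE i hi.1).1, hi.2.1⟩,
        Finset.mem_sdiff.2 ⟨(hE i hi.1).2, hi.2.2⟩⟩) (by omega) (by omega)
  exact hno ⟨H, hH.trans (Finset.filter_subset _ _), hH'⟩

/-! ### Parities of chord sets on order-convex sets -/

/-- The indicator of a set with values in `ZMod 2`. -/
noncomputable def chi {β : Type*} (I : Set β) (x : β) : ZMod 2 := I.indicator 1 x

theorem chi_of_mem {β : Type*} {I : Set β} {x : β} (h : x ∈ I) : chi I x = 1 := by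
  simp [chi, h]

theorem chi_of_notMem {β : Type*} {I : Set β} {x : β} (h : x ∉ I) : chi I x = 0 := by
  simp [chi, h]

theorem chi_congr {β : Type*} {I : Set β} {x y : β} (h : x ∈ I ↔ y ∈ I) : chi I x = chi I y := by
  by_cases hx : x ∈ I
  · rw [chi_of_mem hx, chi_of_mem (h.1 hx)]
  · rw [chi_of_notMem hx, chi_of_notMem (fun hy => hx (h.2 hy))]

/-- The parity of the number of ends that the edge set `H` has in `I`. -/
noncomputable def parity {α β : Type*} (s t : α → β) (I : Set β) (H : Finset α) : ZMod 2 :=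
  ∑ i ∈ H, (chi I (s i) + chi I (t i))

theorem chi_add_chi_ne_zero {β : Type*} {I : Set β} {x y : β} :
    chi I x + chi I y ≠ 0 ↔ (x ∈ I ∧ y ∉ I) ∨ (y ∈ I ∧ x ∉ I) := by
  by_cases hx : x ∈ I <;> by_cases hy : y ∈ I <;>
    simp [chi, hx, hy, zmod_two_add_self]

theorem exists_of_parity_ne_zero {α β : Type*} {s t : α → β} {I : Set β} {H : Finset α}
    (h : parity s t I H ≠ 0) : ∃ i ∈ H, (s i ∈ I ∧ t i ∉ I) ∨ (t i ∈ I ∧ s i ∉ I) := by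
  obtain ⟨i, hi, h⟩ := Finset.exists_ne_zero_of_sum_ne_zero h
  exact ⟨i, hi, chi_add_chi_ne_zero.1 h⟩

theorem parity_singleton_ne_zero {α β : Type*} {s t : α → β} {I : Set β} {i : α} :
    parity s t I {i} ≠ 0 ↔ (s i ∈ I ∧ t i ∉ I) ∨ (t i ∈ I ∧ s i ∉ I) := by
  rw [parity, Finset.sum_singleton, chi_add_chi_ne_zero]

/-- Sorting a finite set by a key. -/
theorem exists_rank {γ : Type*} [DecidableEq γ] (f : γ → ℕ) (T : Finset γ) :
    ∃ ρ : γ → ℕ, Set.InjOn ρ T ∧ (∀ x ∈ T, ρ x < T.card) ∧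
      ∀ x ∈ T, ∀ y ∈ T, ρ x ≤ ρ y → f x ≤ f y := by
  induction T using Finset.induction_on_max_value f with
  | empty => exact ⟨fun _ => 0, by simp, by simp, by simp⟩
  | insert a s ha hmax ih =>
    obtain ⟨ρ, h1, h2, h3⟩ := ih
    have hne : ∀ x ∈ s, x ≠ a := fun x hx h => ha (h ▸ hx)
    refine ⟨fun x => if x = a then s.card else ρ x, ?_, ?_, ?_⟩
    · intro x hx y hy hxy
      simp only [Finset.coe_insert, Set.mem_insert_iff, Finset.mem_coe] at hx hy
      rcases hx with rfl | hx <;> rcases hy with rfl | hy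
      · rfl
      · have := h2 y hy
        simp only [if_true, if_neg (hne y hy)] at hxy
        omega
      · have := h2 x hx
        simp only [if_true, if_neg (hne x hx)] at hxy
        omega
      · simp only [if_neg (hne x hx), if_neg (hne y hy)] at hxy
        exact h1 hx hy hxy
    · intro x hx
      rw [Finset.card_insert_of_notMem ha]
      rcases Finset.mem_insert.1 hx with rfl | hx
      · simp
      · have := h2 x hx
        simp only [if_neg (hne x hx)]
        omega
    · intro x hx y hy hxy
      rcases Finset.mem_insert.1 hx with rfl | hx' <;> rcases Finset.mem_insert.1 hy with rfl | hy'
      · rfl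
      · have := h2 y hy'
        simp only [if_true, if_neg (hne y hy')] at hxy
        omega
      · exact hmax x hx'
      · simp only [if_neg (hne x hx'), if_neg (hne y hy')] at hxy
        exact h3 x hx' y hy' hxy

/-- An order-convex set splits at most two of a sequence of consecutive blocks. -/
theorem card_split_le_two {β : Type*} [Preorder β] {I : Set β} (hI : I.OrdConnected)
    (X : Finset ℕ)
    (p q : ℕ → β) (hp : ∀ b ∈ X, p b ∈ I) (hq : ∀ b ∈ X, q b ∉ I)
    (hpq : ∀ b ∈ X, ∀ c ∈ X, b < c → p b ≤ q c ∧ q b ≤ p c) : X.card ≤ 2 := by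
  rcases X.eq_empty_or_nonempty with rfl | hne
  · simp
  -- A split block strictly between the first and the last would have its outside point between two
  -- points of `I`.
  refine (Finset.card_le_card (t := {X.min' hne, X.max' hne}) ?_).trans Finset.card_le_two
  intro b hb
  by_contra hbn
  simp only [Finset.mem_insert, Finset.mem_singleton, not_or] at hbn
  have h1 : X.min' hne < b := lt_of_le_of_ne (X.min'_le b hb) (Ne.symm hbn.1)
  have h2 : b < X.max' hne := lt_of_le_of_ne (X.le_max' b hb) hbn.2
  exact hq b hb (hI.out (hp _ (X.min'_mem hne)) (hp _ (X.max'_mem hne))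
    ⟨(hpq _ (X.min'_mem hne) b hb h1).1, (hpq b hb _ (X.max'_mem hne) h2).2⟩)

end CycleCover

/-! ### The closing lemma -/

namespace CycleCover

open Finset

/-- Greedy removal of short even sets, which stops only when the density hypothesis of
`exists_short_even_set` fails. -/
theorem exists_peeling {α β : Type*} [DecidableEq α] [DecidableEq β] (s t : α → β) (k : ℕ)
    (N : Finset β) (hk : N.card < 2 ^ k) (E : Finset α) : (∀ i ∈ E, s i ∈ N ∧ t i ∈ N) →
    ∃ 𝓗 : Finset (Finset α), (∀ H ∈ 𝓗, H ⊆ E ∧ H.Nonempty ∧ H.card ≤ 2 * k + 1 ∧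
        ∀ g : β → ZMod 2, ∑ i ∈ H, (g (s i) + g (t i)) = 0) ∧
      (𝓗 : Set (Finset α)).PairwiseDisjoint id ∧ (E \ 𝓗.biUnion id).card ≤ 2 * N.card := by
  induction E using Finset.strongInduction with
  | H E ih =>
  intro hE
  by_cases hc : E.card ≤ 2 * N.card
  · exact ⟨∅, by simp, by simp, by simpa using hc⟩
  obtain ⟨H, hHE, hHne, hHc, hHg⟩ := exists_short_even_set s t k N E hE hk (by omega)
  obtain ⟨𝓗, h1, h2, h3⟩ := ih (E \ H) (Finset.sdiff_ssubset hHE hHne)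
    (fun i hi => hE i (Finset.mem_sdiff.1 hi).1)
  refine ⟨insert H 𝓗, ?_, ?_, ?_⟩
  · intro H' hH'
    rcases Finset.mem_insert.1 hH' with rfl | hH'
    · exact ⟨hHE, hHne, hHc, hHg⟩
    · exact ⟨(h1 H' hH').1.trans Finset.sdiff_subset, (h1 H' hH').2⟩
  · rw [Finset.coe_insert]
    refine h2.insert fun H' hH' _ => ?_
    exact (Finset.disjoint_of_subset_left (h1 H' hH').1 Finset.sdiff_disjoint).symm
  · convert h3 using 2
    ext x
    simp only [Finset.biUnion_insert, id, Finset.mem_union, Finset.mem_sdiff]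
    tauto

/-- One round of the closing lemma: at least half of the chords can be put into disjoint small
sets whose parities are rarely odd on order-convex sets. -/
theorem exists_half_closing {α : Type*} [DecidableEq α] (s t : α → ℕ) (q : ℕ) (E : Finset α)
    (h4 : 4 ≤ E.card) (hq : E.card ≤ 2 ^ q) :
    ∃ 𝓗 : Finset (Finset α), (∀ H ∈ 𝓗, H ⊆ E ∧ H.Nonempty ∧ H.card ≤ 2 * q + 1) ∧
      (𝓗 : Set (Finset α)).PairwiseDisjoint id ∧ 2 * (E \ 𝓗.biUnion id).card ≤ E.card ∧
      ∀ I : Set ℕ, I.OrdConnected → (𝓗.filter (fun H => parity s t I H ≠ 0)).card ≤ 32 := by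
  classical
  set T : Finset (α × Bool) := E ×ˢ Finset.univ with hT
  have hTc : T.card = 2 * E.card := by simp [hT, mul_comm]
  let f : α × Bool → ℕ := fun τ => if τ.2 then s τ.1 else t τ.1
  obtain ⟨ρ, hρinj, hρlt, hρmono⟩ := exists_rank f T
  -- Blocks of 16 consecutive ends turn `2 * E.card` ends into at most `E.card / 8 + 1` nodes.
  -- Peeling then leaves at most `2 * (E.card / 8 + 1)` chords, which is at most half of them once
  -- `4 ≤ E.card`.
  let blk : α × Bool → ℕ := fun τ => ρ τ / 16
  have hmemT : ∀ i ∈ E, ∀ b, (i, b) ∈ T := fun i hi b => by simp [hT, hi]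
  have hblk : ∀ τ ∈ T, blk τ ∈ Finset.range (E.card / 8 + 1) := by
    intro τ hτ
    have := hρlt τ hτ
    simp only [Finset.mem_range, blk]
    omega
  obtain ⟨𝓗, h1, h2, h3⟩ := exists_peeling (fun i => blk (i, true)) (fun i => blk (i, false)) q
    (Finset.range (E.card / 8 + 1)) (by rw [Finset.card_range]; omega) E
    (fun i hi => ⟨hblk _ (hmemT i hi _), hblk _ (hmemT i hi _)⟩)
  refine ⟨𝓗, fun H hH => ⟨(h1 H hH).1, (h1 H hH).2.1, (h1 H hH).2.2.1⟩, h2, ?_, ?_⟩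
  · rw [Finset.card_range] at h3
    omega
  intro I hI
  -- A representative position for each block; the value `0` for an empty block is never used.
  have hcen : ∀ b, ∃ c : ℕ, (∃ τ ∈ T, blk τ = b) → ∃ τ ∈ T, blk τ = b ∧ f τ = c := by
    intro b
    by_cases h : ∃ τ ∈ T, blk τ = b
    · obtain ⟨τ, h1, h2⟩ := h
      exact ⟨f τ, fun _ => ⟨τ, h1, h2, rfl⟩⟩
    · exact ⟨0, fun h' => absurd h' h⟩
  choose cen hcen using hcen
  set X := (Finset.range (E.card / 8 + 1)).filter (fun b =>
    ∃ x y, (∃ τ ∈ T, blk τ = b ∧ f τ = x) ∧ (∃ τ ∈ T, blk τ = b ∧ f τ = y) ∧ x ∈ I ∧ y ∉ I)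
    with hX
  have hX2 : X.card ≤ 2 := by
    have : ∀ b ∈ X, ∃ x y, (∃ τ ∈ T, blk τ = b ∧ f τ = x) ∧
        (∃ τ ∈ T, blk τ = b ∧ f τ = y) ∧ x ∈ I ∧ y ∉ I := fun b hb => (Finset.mem_filter.1 hb).2
    choose! p r hp using this
    have hlt : ∀ b c x y, b < c → (∃ τ ∈ T, blk τ = b ∧ f τ = x) →
        (∃ τ ∈ T, blk τ = c ∧ f τ = y) → x ≤ y := by
      rintro b c x y hbc ⟨τ, hτ, rfl, rfl⟩ ⟨τ', hτ', rfl, rfl⟩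
      apply hρmono τ hτ τ' hτ'
      simp only [blk] at hbc
      omega
    refine card_split_le_two hI X p r (fun b hb => (hp b hb).2.2.1) (fun b hb => (hp b hb).2.2.2)
      fun b hb c hc hbc => ⟨hlt b c _ _ hbc (hp b hb).1 (hp c hc).2.1,
        hlt b c _ _ hbc (hp b hb).2.1 (hp c hc).1⟩
  have hbad : (T.filter (fun τ => blk τ ∈ X)).card ≤ 16 * X.card := by
    refine Finset.card_le_mul_card_image_of_maps_to (f := blk)
      (fun τ hτ => (Finset.mem_filter.1 hτ).2) 16 fun b _ => ?_
    refine (Finset.card_le_card_of_injOn (t := Finset.Ico (16 * b) (16 * b + 16)) ρ ?_ ?_).trans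
      (by simp)
    · intro τ hτ
      simp only [Finset.coe_filter, Set.mem_ofPred_eq, blk] at hτ
      simp only [Finset.coe_Ico, Set.mem_Ico]
      omega
    · refine hρinj.mono fun τ hτ => ?_
      simp only [Finset.coe_filter, Set.mem_ofPred_eq, Finset.mem_filter] at hτ
      exact hτ.1.1
  have hodd : ∀ H ∈ 𝓗.filter (fun H => parity s t I H ≠ 0),
      ∃ τ ∈ T.filter (fun τ => blk τ ∈ X), τ.1 ∈ H := by
    intro H hH
    rw [Finset.mem_filter] at hH
    by_contra! hno
    apply hH.2
    -- If `H` has no end in a split block, each end may be replaced by the representative of its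
    -- block. The parity of `H` becomes an evaluation of the even set at the node function `chi I ∘
    -- cen`, hence zero.
    have key : ∀ i ∈ H, ∀ b, chi I (f (i, b)) = chi I (cen (blk (i, b))) := by
      intro i hi b
      have hiT := hmemT i ((h1 H hH.1).1 hi) b
      obtain ⟨τ, hτ, hτb, hτf⟩ := hcen (blk (i, b)) ⟨_, hiT, rfl⟩
      have hn : ∀ x y, (∃ τ ∈ T, blk τ = blk (i, b) ∧ f τ = x) →
          (∃ τ ∈ T, blk τ = blk (i, b) ∧ f τ = y) → x ∈ I → y ∈ I := by
        intro x y hx hy hxI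
        by_contra hyI
        exact hno (i, b) (Finset.mem_filter.2
          ⟨hiT, Finset.mem_filter.2 ⟨hblk _ hiT, x, y, hx, hy, hxI, hyI⟩⟩) hi
      exact chi_congr ⟨hn _ _ ⟨_, hiT, rfl, rfl⟩ ⟨τ, hτ, hτb, hτf⟩,
        hn _ _ ⟨τ, hτ, hτb, hτf⟩ ⟨_, hiT, rfl, rfl⟩⟩
    rw [parity, ← (h1 H hH.1).2.2.2 (fun b => chi I (cen b))]
    refine Finset.sum_congr rfl fun i hi => ?_
    have e1 := key i hi true
    have e2 := key i hi false
    simp only [f, if_true, Bool.false_eq_true, if_false] at e1 e2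
    rw [e1, e2]
  obtain ⟨i₀, hi₀⟩ : E.Nonempty := Finset.card_pos.1 (by omega)
  have : Nonempty (α × Bool) := ⟨(i₀, true)⟩
  choose! w hw hwH using hodd
  -- Disjoint odd sets use different ends in the at most two split blocks: `16 * 2 = 32`.
  refine (Finset.card_le_card_of_injOn w hw ?_).trans (hbad.trans (by omega))
  intro H hH H' hH' heq
  by_contra hne
  have hd := h2 (Finset.mem_filter.1 hH).1 (Finset.mem_filter.1 hH').1 hne
  exact Finset.disjoint_left.1 hd (hwH H hH) (heq ▸ hwH H' hH')

/-- **Closing lemma.** The chords can be partitioned into sets of logarithmic size such that every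
order-convex set has odd parity on only logarithmically many of them. -/
theorem exists_closing_partition {α : Type*} [DecidableEq α] (s t : α → ℕ) (q m : ℕ) :
    ∀ E : Finset α, E.card ≤ 2 ^ m → E.card ≤ 2 ^ q →
    ∃ 𝓗 : Finset (Finset α), (∀ H ∈ 𝓗, H ⊆ E ∧ H.Nonempty ∧ H.card ≤ 2 * q + 1) ∧
      (𝓗 : Set (Finset α)).PairwiseDisjoint id ∧ 𝓗.biUnion id = E ∧
      ∀ I : Set ℕ, I.OrdConnected →
        (𝓗.filter (fun H => parity s t I H ≠ 0)).card ≤ 32 * m + 3 := by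
  -- At most three chords are left as singletons, which accounts for the `+ 3`.
  have small : ∀ m, ∀ E : Finset α, E.card ≤ 3 →
    ∃ 𝓗 : Finset (Finset α), (∀ H ∈ 𝓗, H ⊆ E ∧ H.Nonempty ∧ H.card ≤ 2 * q + 1) ∧
      (𝓗 : Set (Finset α)).PairwiseDisjoint id ∧ 𝓗.biUnion id = E ∧
      ∀ I : Set ℕ, I.OrdConnected →
        (𝓗.filter (fun H => parity s t I H ≠ 0)).card ≤ 32 * m + 3 := by
    intro m E hE
    refine ⟨E.image singleton, ?_, ?_, ?_, fun I _ => ?_⟩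
    · intro H hH
      obtain ⟨i, hi, rfl⟩ := Finset.mem_image.1 hH
      simpa using hi
    · intro H hH H' hH' hne
      obtain ⟨i, hi, rfl⟩ := Finset.mem_image.1 (Finset.mem_coe.1 hH)
      obtain ⟨j, hj, rfl⟩ := Finset.mem_image.1 (Finset.mem_coe.1 hH')
      simpa [Function.onFun] using fun h : i = j => hne (by rw [h])
    · ext i; simp
    · have h1 := Finset.card_filter_le (E.image singleton) (fun H => parity s t I H ≠ 0)
      have h2 : (E.image (singleton : α → Finset α)).card ≤ E.card := Finset.card_image_le
      omega
  -- The exponent `m` counts the halving rounds, at 32 odd sets each, while `q` stays fixed so that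
  -- the size bound is the same in every round.
  induction m with
  | zero => intro E hE _; exact small 0 E (by simp at hE; omega)
  | succ m ih =>
    intro E hE hq
    by_cases h4 : E.card ≤ 3
    · exact small _ E h4
    obtain ⟨𝓗, a1, a2, a3, a4⟩ := exists_half_closing s t q E (by omega) hq
    have hsub : 𝓗.biUnion id ⊆ E := Finset.biUnion_subset.2 fun H hH => (a1 H hH).1
    obtain ⟨𝓗', b1, b2, b3, b4⟩ := ih (E \ 𝓗.biUnion id) (by rw [pow_succ] at hE; omega) (by omega)
    refine ⟨𝓗 ∪ 𝓗', ?_, ?_, ?_, fun I hI => ?_⟩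
    · intro H hH
      rcases Finset.mem_union.1 hH with h | h
      · exact a1 H h
      · exact ⟨(b1 H h).1.trans Finset.sdiff_subset, (b1 H h).2⟩
    · rw [Finset.coe_union]
      refine (Set.pairwiseDisjoint_union).2 ⟨a2, b2, fun H hH H' hH' _ => ?_⟩
      refine Finset.disjoint_of_subset_left (Finset.subset_biUnion_of_mem id hH) ?_
      exact (Finset.disjoint_of_subset_left (b1 H' hH').1 Finset.sdiff_disjoint).symm
    · rw [Finset.union_biUnion, b3, Finset.union_sdiff_of_subset hsub]
    · rw [Finset.filter_union]
      have := Finset.card_union_le (𝓗.filter (fun H => parity s t I H ≠ 0))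
        (𝓗'.filter (fun H => parity s t I H ≠ 0))
      have := a4 I hI
      have := b4 I hI
      omega

end CycleCover

/-! ### Sparse families, and intervals that do not separate one side of the chords -/

namespace CycleCover

open Finset

open Classical in
/-- A family `𝓗` of sets of at most `ℓ` chords from `A` such that every chord is in at most `c` of
them and every set in `𝓘` has odd parity on at most `d` of them. -/
structure IsSparse {α β : Type*} (s t : α → β) (A : Finset α) (𝓘 : Set (Set β)) (ℓ c d : ℕ)
    (𝓗 : Finset (Finset α)) : Prop where
  subset : ∀ H ∈ 𝓗, H ⊆ A
  card_le : ∀ H ∈ 𝓗, H.card ≤ ℓ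
  chord_le : ∀ a, (𝓗.filter (fun H => a ∈ H)).card ≤ c
  cut_le : ∀ I ∈ 𝓘, (𝓗.filter (fun H => parity s t I H ≠ 0)).card ≤ d

section IsSparse

variable {α β : Type*} {s t : α → β} {A A' : Finset α} {𝓘 𝓘' : Set (Set β)} {ℓ c d ℓ' c' d' : ℕ}
  {𝓗 𝓗' : Finset (Finset α)}

theorem IsSparse.mono (h : IsSparse s t A 𝓘 ℓ c d 𝓗) (hA : A ⊆ A') (hI : 𝓘' ⊆ 𝓘) (hℓ : ℓ ≤ ℓ')
    (hc : c ≤ c') (hd : d ≤ d') : IsSparse s t A' 𝓘' ℓ' c' d' 𝓗 :=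
  ⟨fun H hH => (h.subset H hH).trans hA, fun H hH => (h.card_le H hH).trans hℓ,
    fun a => (h.chord_le a).trans hc, fun I hI' => (h.cut_le I (hI hI')).trans hd⟩

open Classical in
theorem IsSparse.union (h : IsSparse s t A 𝓘 ℓ c d 𝓗) (h' : IsSparse s t A 𝓘 ℓ c' d' 𝓗') :
    IsSparse s t A 𝓘 ℓ (c + c') (d + d') (𝓗 ∪ 𝓗') := by
  refine ⟨fun H hH => ?_, fun H hH => ?_, fun a => ?_, fun I hI => ?_⟩
  · exact (Finset.mem_union.1 hH).elim (h.subset H) (h'.subset H)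
  · exact (Finset.mem_union.1 hH).elim (h.card_le H) (h'.card_le H)
  · rw [Finset.filter_union]
    exact (Finset.card_union_le _ _).trans (add_le_add (h.chord_le a) (h'.chord_le a))
  · rw [Finset.filter_union]
    exact (Finset.card_union_le _ _).trans (add_le_add (h.cut_le I hI) (h'.cut_le I hI))

theorem isSparse_empty : IsSparse s t A 𝓘 ℓ 0 0 ∅ := by
  constructor <;> simp

open Classical in
theorem isSparse_singleton (hA : A' ⊆ A) (hℓ : A'.card ≤ ℓ) : IsSparse s t A 𝓘 ℓ 1 1 {A'} := by
  refine ⟨by simpa using hA, by simpa using hℓ, fun a => ?_, fun I _ => ?_⟩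
  all_goals exact (Finset.card_filter_le _ _).trans (by simp)

theorem parity_symmDiff [DecidableEq α] (I : Set β) (B C : Finset α) :
    parity s t I (symmDiff B C) = parity s t I B + parity s t I C :=
  sum_symmDiff_zmod_two _ _ _

theorem parity_swap (I : Set β) (B : Finset α) : parity t s I B = parity s t I B :=
  Finset.sum_congr rfl fun _ _ => add_comm _ _

theorem IsSparse.swap (h : IsSparse s t A 𝓘 ℓ c d 𝓗) : IsSparse t s A 𝓘 ℓ c d 𝓗 :=
  ⟨h.subset, h.card_le, h.chord_le, fun I hI => by simpa only [parity_swap] using h.cut_le I hI⟩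

end IsSparse

/-- If each of finitely many functionals is nonzero on some element of `A`, then at least half of
them are nonzero on the sum of a common subset of `A`. -/
theorem exists_half_odd {ε α : Type*} [DecidableEq α] (φ : ε → α → ZMod 2) (A : Finset α) :
    ∀ W : Finset ε, (∀ e ∈ W, ∃ a ∈ A, φ e a ≠ 0) →
    ∃ B ⊆ A, W.card ≤ 2 * (W.filter (fun e => ∑ a ∈ B, φ e a ≠ 0)).card := by
  classical
  induction A using Finset.induction_on with
  | empty =>
    intro W hW
    refine ⟨∅, by simp, ?_⟩
    have : W = ∅ := Finset.eq_empty_of_forall_notMem fun e he => by simpa using hW e he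
    simp [this]
  | insert a A ha ih =>
    intro W hW
    obtain ⟨B, hB, hBc⟩ := ih (W.filter (fun e => φ e a = 0)) (by
      intro e he
      rw [Finset.mem_filter] at he
      obtain ⟨a', ha', h⟩ := hW e he.1
      rcases Finset.mem_insert.1 ha' with rfl | h'
      · exact absurd he.2 h
      · exact ⟨a', h', h⟩)
    have haB : a ∉ B := fun h => ha (hB h)
    have hsplit : ∀ (P : ε → Prop) [DecidablePred P], (W.filter P).card =
        ((W.filter (fun e => φ e a = 0)).filter P).card +
          ((W.filter (fun e => φ e a ≠ 0)).filter P).card := by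
      intro P _
      rw [← Finset.card_filter_add_card_filter_not (s := W.filter P) (fun e => φ e a = 0)]
      congr 2 <;> ext e <;> simp only [Finset.mem_filter] <;> tauto
    have hW' := Finset.card_filter_add_card_filter_not (s := W) (fun e => φ e a = 0)
    have hW2 := Finset.card_filter_add_card_filter_not
      (s := W.filter (fun e => φ e a ≠ 0)) (fun e => ∑ i ∈ B, φ e i ≠ 0)
    -- Adding `a` to `B` flips the parity of precisely those functionals that are nonzero at `a`.
    -- One of `B` and `insert a B` is therefore odd for half of them, and the other functionals do
    -- not notice the change.
    by_cases hc : (W.filter (fun e => φ e a ≠ 0)).card ≤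
        2 * ((W.filter (fun e => φ e a ≠ 0)).filter (fun e => ∑ i ∈ B, φ e i ≠ 0)).card
    · refine ⟨B, hB.trans (Finset.subset_insert _ _), ?_⟩
      rw [hsplit]
      simp only [ne_eq] at *
      omega
    · refine ⟨insert a B, Finset.insert_subset_insert _ hB, ?_⟩
      rw [hsplit]
      have e1 : (W.filter (fun e => φ e a = 0)).filter (fun e => ∑ i ∈ insert a B, φ e i ≠ 0) =
          (W.filter (fun e => φ e a = 0)).filter (fun e => ∑ i ∈ B, φ e i ≠ 0) := by
        refine Finset.filter_congr fun e he => ?_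
        rw [Finset.sum_insert haB, (Finset.mem_filter.1 he).2, zero_add]
      have e2 : (W.filter (fun e => φ e a ≠ 0)).filter (fun e => ∑ i ∈ insert a B, φ e i ≠ 0) =
          (W.filter (fun e => φ e a ≠ 0)).filter (fun e => ¬ ∑ i ∈ B, φ e i ≠ 0) := by
        refine Finset.filter_congr fun e he => ?_
        have h1 := (Finset.mem_filter.1 he).2
        rw [Finset.sum_insert haB]
        generalize φ e a = x at h1 ⊢
        generalize ∑ i ∈ B, φ e i = y
        revert x y
        decide
      rw [e1, e2]
      simp only [ne_eq] at *
      omega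

theorem exists_unique_of_sum_ne_zero {κ : Type*} (R : Finset κ) (f : κ → ZMod 2)
    (h : ∑ k ∈ R, f k ≠ 0) (h2 : (R.filter (fun k => f k ≠ 0)).card ≤ 2) :
    ∃ k ∈ R, f k ≠ 0 ∧ ∀ k' ∈ R, f k' ≠ 0 → k' = k := by
  have h1 : ∑ k ∈ R, f k = ((R.filter (fun k => f k ≠ 0)).card : ZMod 2) := by
    rw [← Finset.sum_filter_ne_zero, Finset.sum_congr rfl (g := fun _ => (1 : ZMod 2)),
      Finset.sum_const, nsmul_one]
    intro k hk
    have := (Finset.mem_filter.1 hk).2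
    generalize f k = x at this
    revert x
    decide
  have h3 : (R.filter (fun k => f k ≠ 0)).card = 1 := by
    rw [h1] at h
    generalize (R.filter (fun k => f k ≠ 0)).card = n at h h2
    interval_cases n
    · simp at h
    · rfl
    · exact absurd (by decide) h
  obtain ⟨k, hk⟩ := Finset.card_eq_one.1 h3
  have hk' := (Finset.mem_filter.1 (hk ▸ Finset.mem_singleton_self k))
  refine ⟨k, hk'.1, hk'.2, fun k' h1 h2 => ?_⟩
  exact Finset.mem_singleton.1 (hk ▸ Finset.mem_filter.2 ⟨h1, h2⟩)

/-- Every even set of chords, sorted by the position of one end, can be split into consecutive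
pairs. -/
theorem exists_sorted_enum {α : Type*} [DecidableEq α] (s : α → ℕ) (B : Finset α) (p : ℕ)
    (hp : B.card = 2 * p) (hne : B.Nonempty) :
    ∃ b : ℕ → α, (∀ r < 2 * p, b r ∈ B) ∧ (∀ a ∈ B, ∃ r < 2 * p, b r = a) ∧
      (∀ r < 2 * p, ∀ r' < 2 * p, b r = b r' → r = r') ∧
      (∀ r < 2 * p, ∀ r' < 2 * p, r ≤ r' → s (b r) ≤ s (b r')) := by
  obtain ⟨ρ, h1, h2, h3⟩ := exists_rank s B
  have himg : B.image ρ = Finset.range (2 * p) := by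
    apply Finset.eq_of_subset_of_card_le
    · intro r hr
      obtain ⟨a, ha, rfl⟩ := Finset.mem_image.1 hr
      rw [Finset.mem_range, ← hp]
      exact h2 a ha
    · rw [Finset.card_image_of_injOn h1, Finset.card_range, hp]
  have hex : ∀ r < 2 * p, ∃ a ∈ B, ρ a = r := by
    intro r hr
    rw [← Finset.mem_range, ← himg] at hr
    simpa using hr
  have : Nonempty α := ⟨hne.choose⟩
  choose! b hb hρ using hex
  have hlt : ∀ a ∈ B, ρ a < 2 * p := fun a ha => hp ▸ h2 a ha
  refine ⟨b, hb, fun a ha => ⟨ρ a, hlt a ha, ?_⟩, fun r hr r' hr' h => ?_, fun r hr r' hr' h => ?_⟩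
  · exact h1 (hb _ (hlt a ha)) ha (hρ _ (hlt a ha))
  · rw [← hρ r hr, h, hρ r' hr']
  · exact h3 _ (hb r hr) _ (hb r' hr') (by rw [hρ r hr, hρ r' hr']; exact h)

/-- Take a chord set `B` that is odd on half of the sets and pair its members consecutively by `s`.
The `t`-ends of a pair cancel on `I e`, and an order-convex set splits the `s`-ends of at most two
pairs, so oddness forces exactly one odd pair. The closing lemma, applied to the `t`-ends of the
pairs, groups them so that other order-convex sets are rarely odd. The group with the odd pair
remains odd. -/
theorem exists_half_cover_of_const {α ε : Type*} (s t : α → ℕ) (q : ℕ) (A : Finset α)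
    (hq : A.card ≤ 2 ^ q) (I : ε → Set ℕ) (W : Finset ε) (hI : ∀ e ∈ W, (I e).OrdConnected)
    (ht : ∀ e ∈ W, ∀ a ∈ A, ∀ a' ∈ A, t a ∈ I e ↔ t a' ∈ I e)
    (a₀ : α) (ha₀ : a₀ ∈ A) (heven : ∀ e ∈ W, parity s t (I e) {a₀} = 0)
    (hW : ∀ e ∈ W, ∃ a ∈ A, parity s t (I e) {a} ≠ 0) :
    ∃ 𝓗, IsSparse s t A {I | I.OrdConnected} (2 * (2 * q + 1)) 1 (32 * q + 5) 𝓗 ∧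
      ∃ W' ⊆ W, W.card ≤ 2 * W'.card ∧ ∀ e ∈ W', ∃ H ∈ 𝓗, parity s t (I e) H ≠ 0 := by
  classical
  obtain ⟨B₀, hB₀, hhalf⟩ := exists_half_odd (fun e a => parity s t (I e) {a}) A W hW
  have hB₀' : ∀ e, ∑ a ∈ B₀, parity s t (I e) {a} = parity s t (I e) B₀ := fun e => by
    simp [parity]
  simp only [hB₀'] at hhalf
  -- Pairing needs an even number of chords; toggling `a₀` achieves it without changing any parity
  -- in question.
  obtain ⟨B, hB, ⟨p, hp⟩, hpar⟩ : ∃ B ⊆ A, Even B.card ∧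
      ∀ e ∈ W, parity s t (I e) B = parity s t (I e) B₀ := by
    rcases Nat.even_or_odd B₀.card with h | h
    · exact ⟨B₀, hB₀, h, fun _ _ => rfl⟩
    · refine ⟨symmDiff B₀ {a₀}, ?_, ?_, fun e he => ?_⟩
      · exact Finset.symmDiff_subset_union.trans
          (Finset.union_subset hB₀ (Finset.singleton_subset_iff.2 ha₀))
      · by_cases ha : a₀ ∈ B₀
        · have : symmDiff B₀ {a₀} = B₀.erase a₀ := by
            ext x; simp only [Finset.mem_symmDiff, Finset.mem_singleton, Finset.mem_erase]
            constructor
            · rintro (h | ⟨rfl, h⟩)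
              · exact ⟨h.2, h.1⟩
              · exact absurd ha h
            · exact fun h => Or.inl ⟨h.2, h.1⟩
          rw [this, Finset.card_erase_of_mem ha]
          exact Nat.Odd.sub_odd h odd_one
        · have : symmDiff B₀ {a₀} = insert a₀ B₀ := by
            ext x; simp only [Finset.mem_symmDiff, Finset.mem_singleton, Finset.mem_insert]
            constructor
            · rintro (h | h)
              · exact Or.inr h.1
              · exact Or.inl h.1
            · rintro (rfl | h)
              · exact Or.inr ⟨rfl, ha⟩
              · exact Or.inl ⟨h, fun h' => ha (h' ▸ h)⟩
          rw [this, Finset.card_insert_of_notMem ha]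
          exact h.add_one
      · rw [parity_symmDiff, heven e he, add_zero]
  rw [← two_mul] at hp
  rcases B.eq_empty_or_nonempty with rfl | hBne
  · refine ⟨∅, isSparse_empty.mono subset_rfl subset_rfl le_rfl (by omega) (by omega), ∅, by simp,
      ?_, by simp⟩
    rw [Finset.filter_eq_empty_iff.2] at hhalf
    · simpa using hhalf
    · intro e he
      rw [← hpar e he]
      simp [parity]
  obtain ⟨b, hbB, hbsurj, hbinj, hbmono⟩ := exists_sorted_enum s B p hp hBne
  let pr : Finset ℕ → Finset α := fun H => H.biUnion fun k => {b (2 * k), b (2 * k + 1)}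
  have hsum : ∀ H ⊆ Finset.range p, ∀ f : α → ZMod 2,
      ∑ a ∈ pr H, f a = ∑ k ∈ H, (f (b (2 * k)) + f (b (2 * k + 1))) := by
    intro H hH f
    have hHp : ∀ k ∈ H, k < p := fun k hk => Finset.mem_range.1 (hH hk)
    rw [Finset.sum_biUnion]
    · refine Finset.sum_congr rfl fun k hk => Finset.sum_pair fun h => ?_
      have := hbinj _ (by have := hHp k hk; omega) _ (by have := hHp k hk; omega) h
      omega
    · intro k hk k' hk' hne
      have h1 := hHp k hk
      have h2 := hHp k' hk'
      rw [Function.onFun, Finset.disjoint_left]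
      intro x hx hx'
      simp only [Finset.mem_insert, Finset.mem_singleton] at hx hx'
      rcases hx with rfl | rfl <;> rcases hx' with h | h <;>
      · have := hbinj _ (by omega) _ (by omega) h
        omega
  have hpB : pr (Finset.range p) = B := by
    ext a
    simp only [pr, Finset.mem_biUnion, Finset.mem_range, Finset.mem_insert, Finset.mem_singleton]
    constructor
    · rintro ⟨k, hk, rfl | rfl⟩ <;> exact hbB _ (by omega)
    · intro ha
      obtain ⟨r, hr, rfl⟩ := hbsurj a ha
      refine ⟨r / 2, by omega, ?_⟩
      rcases Nat.mod_two_eq_zero_or_one r with h | h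
      · left; congr 1; omega
      · right; congr 1; omega
  have hprB : ∀ H ⊆ Finset.range p, pr H ⊆ B := fun H hH =>
    hpB ▸ Finset.biUnion_subset_biUnion_of_subset_left _ hH
  have hpq : p ≤ 2 ^ q := by
    have := Finset.card_le_card hB
    omega
  -- Each pair acts as a new chord that joins the `t`-ends of its two members.
  obtain ⟨𝓗, c1, c2, c3, c4⟩ := exists_closing_partition (fun k => t (b (2 * k)))
    (fun k => t (b (2 * k + 1))) q q (Finset.range p) (by simpa) (by simpa)
  have hparity : ∀ J : Set ℕ, ∀ H ⊆ Finset.range p, parity s t J (pr H) =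
      parity (fun k => s (b (2 * k))) (fun k => s (b (2 * k + 1))) J H +
      parity (fun k => t (b (2 * k))) (fun k => t (b (2 * k + 1))) J H := by
    intro J H hH
    rw [parity, hsum H hH, parity, parity, ← Finset.sum_add_distrib]
    exact Finset.sum_congr rfl fun k _ => by ring
  have hsplit : ∀ J : Set ℕ, J.OrdConnected → ((Finset.range p).filter
      (fun k => chi J (s (b (2 * k))) + chi J (s (b (2 * k + 1))) ≠ 0)).card ≤ 2 := by
    intro J hJ
    have : ∀ k ∈ (Finset.range p).filter
        (fun k => chi J (s (b (2 * k))) + chi J (s (b (2 * k + 1))) ≠ 0),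
        ∃ x y, x ∈ J ∧ y ∉ J ∧ (s (b (2 * k)) ≤ x ∧ x ≤ s (b (2 * k + 1))) ∧
          (s (b (2 * k)) ≤ y ∧ y ≤ s (b (2 * k + 1))) := by
      intro k hk
      rw [Finset.mem_filter, chi_add_chi_ne_zero, Finset.mem_range] at hk
      have hle := hbmono (2 * k) (by omega) (2 * k + 1) (by omega) (by omega)
      rcases hk.2 with ⟨h1, h2⟩ | ⟨h1, h2⟩
      · exact ⟨_, _, h1, h2, ⟨le_rfl, hle⟩, ⟨hle, le_rfl⟩⟩
      · exact ⟨_, _, h1, h2, ⟨hle, le_rfl⟩, ⟨le_rfl, hle⟩⟩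
    choose! x y hxy using this
    refine card_split_le_two hJ _ x y (fun k hk => (hxy k hk).1) (fun k hk => (hxy k hk).2.1) ?_
    intro k hk k' hk' hlt
    have h1 := (hxy k hk).2.2
    have h2 := (hxy k' hk').2.2
    rw [Finset.mem_filter, Finset.mem_range] at hk hk'
    have h3 := hbmono (2 * k + 1) (by omega) (2 * k') (by omega) (by omega)
    omega
  have hone : ∀ k, (𝓗.filter (fun H => k ∈ H)).card ≤ 1 := by
    intro k
    refine Finset.card_le_one.2 fun H hH H' hH' => ?_
    rw [Finset.mem_filter] at hH hH'
    by_contra hne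
    exact Finset.disjoint_left.1 (c2 hH.1 hH'.1 hne) hH.2 hH'.2
  refine ⟨𝓗.image pr, ⟨?_, ?_, ?_, ?_⟩, W.filter (fun e => parity s t (I e) B₀ ≠ 0),
    Finset.filter_subset _ _, hhalf, ?_⟩
  · intro H hH
    obtain ⟨H, hH₁, rfl⟩ := Finset.mem_image.1 hH
    exact (hprB H (c1 H hH₁).1).trans hB
  · intro H hH
    obtain ⟨H, hH₁, rfl⟩ := Finset.mem_image.1 hH
    have h1 : (pr H).card ≤ H.card * 2 :=
      Finset.card_biUnion_le_card_mul _ _ _ fun k _ => Finset.card_le_two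
    have := (c1 H hH₁).2.2
    omega
  · intro a
    by_cases ha : a ∈ B
    · obtain ⟨r, hr, rfl⟩ := hbsurj a ha
      rw [Finset.filter_image]
      refine Finset.card_image_le.trans (le_trans (Finset.card_le_card ?_) (hone (r / 2)))
      intro H hH
      rw [Finset.mem_filter] at hH ⊢
      refine ⟨hH.1, ?_⟩
      have hmem := hH.2
      simp only [pr, Finset.mem_biUnion, Finset.mem_insert, Finset.mem_singleton] at hmem
      obtain ⟨k, hk, h⟩ := hmem
      have hkp := Finset.mem_range.1 ((c1 H hH.1).1 hk)
      have : r / 2 = k := by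
        rcases h with h | h <;>
        · have := hbinj _ hr _ (by omega) h
          omega
      rwa [this]
    · rw [Finset.filter_eq_empty_iff.2]
      · simp
      · intro H hH haH
        obtain ⟨H, hH₁, rfl⟩ := Finset.mem_image.1 hH
        exact ha (hprB H (c1 H hH₁).1 haH)
  · intro J hJ
    rw [Finset.filter_image]
    refine Finset.card_image_le.trans ?_
    -- An odd group is odd on its `t`-ends, which happens at most `32 * q + 3` times, or contains
    -- one of the at most two pairs split on the `s`-side.
    have hsub : 𝓗.filter (fun H => parity s t J (pr H) ≠ 0) ⊆
        𝓗.filter (fun H => parity (fun k => t (b (2 * k))) (fun k => t (b (2 * k + 1))) J H ≠ 0) ∪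
        𝓗.filter (fun H => ∃ k ∈ (Finset.range p).filter
          (fun k => chi J (s (b (2 * k))) + chi J (s (b (2 * k + 1))) ≠ 0), k ∈ H) := by
      intro H hH
      rw [Finset.mem_filter] at hH
      rw [Finset.mem_union, Finset.mem_filter, Finset.mem_filter]
      by_contra! hno
      apply hH.2
      rw [hparity J H (c1 H hH.1).1, hno.1 hH.1, add_zero]
      refine Finset.sum_eq_zero fun k hk => ?_
      by_contra hk0
      exact hno.2 hH.1 k (Finset.mem_filter.2 ⟨(c1 H hH.1).1 hk, hk0⟩) hk
    have hB2 : (𝓗.filter (fun H => ∃ k ∈ (Finset.range p).filter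
          (fun k => chi J (s (b (2 * k))) + chi J (s (b (2 * k + 1))) ≠ 0), k ∈ H)).card ≤ 2 := by
      refine le_trans ?_ (hsplit J hJ)
      have : ∀ H ∈ 𝓗.filter (fun H => ∃ k ∈ (Finset.range p).filter
          (fun k => chi J (s (b (2 * k))) + chi J (s (b (2 * k + 1))) ≠ 0), k ∈ H),
          ∃ k ∈ (Finset.range p).filter
          (fun k => chi J (s (b (2 * k))) + chi J (s (b (2 * k + 1))) ≠ 0), k ∈ H :=
        fun H hH => (Finset.mem_filter.1 hH).2
      choose! w hw hwH using this
      refine Finset.card_le_card_of_injOn w hw fun H hH H' hH' heq => ?_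
      by_contra hne
      exact Finset.disjoint_left.1
        (c2 (Finset.mem_filter.1 hH).1 (Finset.mem_filter.1 hH').1 hne) (hwH H hH)
        (heq ▸ hwH H' hH')
    have h1 := Finset.card_le_card hsub
    have h2 := Finset.card_union_le
      (𝓗.filter (fun H => parity (fun k => t (b (2 * k))) (fun k => t (b (2 * k + 1))) J H ≠ 0))
      (𝓗.filter (fun H => ∃ k ∈ (Finset.range p).filter
          (fun k => chi J (s (b (2 * k))) + chi J (s (b (2 * k + 1))) ≠ 0), k ∈ H))
    have h3 := c4 J hJ
    omega
  · intro e he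
    rw [Finset.mem_filter] at he
    obtain ⟨heW, hodd⟩ := he
    have htz : ∀ H ⊆ Finset.range p,
        parity (fun k => t (b (2 * k))) (fun k => t (b (2 * k + 1))) (I e) H = 0 := by
      intro H hH
      refine Finset.sum_eq_zero fun k hk => ?_
      have hkp := Finset.mem_range.1 (hH hk)
      rw [chi_congr (ht e heW _ (hB (hbB (2 * k) (by omega))) _
        (hB (hbB (2 * k + 1) (by omega)))), zmod_two_add_self]
    rw [← hpar e heW, ← hpB, hparity _ _ subset_rfl, htz _ subset_rfl, add_zero] at hodd
    -- The number of odd pairs is odd and at most two, hence one.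
    obtain ⟨k, hk, hk0, huniq⟩ := exists_unique_of_sum_ne_zero _ _ hodd (hsplit _ (hI e heW))
    rw [← c3, Finset.mem_biUnion] at hk
    obtain ⟨H, hH, hkH⟩ := hk
    change k ∈ H at hkH
    refine ⟨pr H, Finset.mem_image_of_mem _ hH, ?_⟩
    have hHp := (c1 H hH).1
    rw [hparity _ _ hHp, htz _ hHp, add_zero, parity, Finset.sum_eq_single_of_mem k hkH]
    · exact hk0
    · intro k' hk' hne
      by_contra h0
      exact hne (huniq k' (hHp hk') h0)

/-- Each application of `exists_half_cover_of_const` halves the uncovered sets, so `j` rounds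
exhaust fewer than `2 ^ j` of them. -/
theorem exists_cover_of_const_aux {α ε : Type*} (s t : α → ℕ) (q : ℕ) (A : Finset α)
    (hq : A.card ≤ 2 ^ q) (I : ε → Set ℕ) (a₀ : α) (ha₀ : a₀ ∈ A) (j : ℕ) :
    ∀ W : Finset ε, W.card < 2 ^ j → (∀ e ∈ W, (I e).OrdConnected) →
    (∀ e ∈ W, ∀ a ∈ A, ∀ a' ∈ A, t a ∈ I e ↔ t a' ∈ I e) →
    (∀ e ∈ W, parity s t (I e) {a₀} = 0) →
    (∀ e ∈ W, ∃ a ∈ A, parity s t (I e) {a} ≠ 0) →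
    ∃ 𝓗, IsSparse s t A {I | I.OrdConnected} (2 * (2 * q + 1)) j (j * (32 * q + 5)) 𝓗 ∧
      ∀ e ∈ W, ∃ H ∈ 𝓗, parity s t (I e) H ≠ 0 := by
  classical
  induction j with
  | zero =>
    intro W hW _ _ _ _
    have : W = ∅ := Finset.card_eq_zero.1 (by simpa using hW)
    subst this
    exact ⟨∅, isSparse_empty.mono subset_rfl subset_rfl le_rfl (by omega) (by omega), by simp⟩
  | succ j ih =>
    intro W hW hI ht heven hodd
    obtain ⟨𝓗, h1, W', hW', hcard, h2⟩ :=
      exists_half_cover_of_const s t q A hq I W hI ht a₀ ha₀ heven hodd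
    have hsd := Finset.card_sdiff_add_card_eq_card hW'
    have hs : W \ W' ⊆ W := Finset.sdiff_subset
    obtain ⟨𝓗', h3, h4⟩ := ih (W \ W') (by rw [pow_succ] at hW; omega) (fun e he => hI e (hs he))
      (fun e he => ht e (hs he)) (fun e he => heven e (hs he)) (fun e he => hodd e (hs he))
    refine ⟨𝓗 ∪ 𝓗', (h1.union h3).mono subset_rfl subset_rfl le_rfl (by omega) (by
      rw [add_mul, one_mul]; omega), fun e he => ?_⟩
    by_cases heW : e ∈ W'
    · obtain ⟨H, hH, h⟩ := h2 e heW
      exact ⟨H, Finset.mem_union_left _ hH, h⟩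
    · obtain ⟨H, hH, h⟩ := h4 e (Finset.mem_sdiff.2 ⟨he, heW⟩)
      exact ⟨H, Finset.mem_union_right _ hH, h⟩

/-- Order-convex sets that do not separate the `t`-ends of the chords can be covered sparsely. -/
theorem exists_cover_of_const {α ε : Type*} (s t : α → ℕ) (q j : ℕ) (A : Finset α)
    (hq : A.card ≤ 2 ^ q) (I : ε → Set ℕ) (W : Finset ε) (hj : W.card < 2 ^ j)
    (hI : ∀ e ∈ W, (I e).OrdConnected)
    (ht : ∀ e ∈ W, ∀ a ∈ A, ∀ a' ∈ A, t a ∈ I e ↔ t a' ∈ I e)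
    (hW : ∀ e ∈ W, ∃ a ∈ A, parity s t (I e) {a} ≠ 0) :
    ∃ 𝓗, IsSparse s t A {I | I.OrdConnected} (2 * (2 * q + 1)) (j + 1) (j * (32 * q + 5) + 1) 𝓗 ∧
      ∀ e ∈ W, ∃ H ∈ 𝓗, parity s t (I e) H ≠ 0 := by
  classical
  rcases A.eq_empty_or_nonempty with rfl | ⟨a₀, ha₀⟩
  · exact ⟨∅, isSparse_empty.mono subset_rfl subset_rfl le_rfl (by omega) (by omega),
      fun e he => by simpa using hW e he⟩
  have hs := Finset.filter_subset (fun e => parity s t (I e) {a₀} = 0) W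
  obtain ⟨𝓗, h1, h2⟩ := exists_cover_of_const_aux s t q A hq I a₀ ha₀ j
    (W.filter (fun e => parity s t (I e) {a₀} = 0)) ((Finset.card_le_card hs).trans_lt hj)
    (fun e he => hI e (hs he)) (fun e he => ht e (hs he))
    (fun e he => (Finset.mem_filter.1 he).2) (fun e he => hW e (hs he))
  -- The sets on which `a₀` is odd are served by the single chord `a₀`.
  refine ⟨𝓗 ∪ {{a₀}}, h1.union (isSparse_singleton (by simpa using ha₀)
    (by rw [Finset.card_singleton]; omega)), ?_⟩
  intro e he
  by_cases h0 : parity s t (I e) {a₀} = 0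
  · obtain ⟨H, hH, h⟩ := h2 e (Finset.mem_filter.2 ⟨he, h0⟩)
    exact ⟨H, Finset.mem_union_left _ hH, h⟩
  · exact ⟨{a₀}, Finset.mem_union_right _ (by simp), h0⟩

end CycleCover

/-! ### Chains, crossing chords and sparse covers of laminar families -/

namespace CycleCover

open Finset

/-- Two sets are nested unless they are disjoint. -/
def IsLaminar {ε β : Type*} (I : ε → Set β) : Prop :=
  ∀ e e', (I e ∩ I e').Nonempty → I e ⊆ I e' ∨ I e' ⊆ I e

/-- In a cover of least cardinality, a member without a private element could be erased. -/
theorem exists_minimal_cover {α ε : Type*} [DecidableEq α] (R : α → ε → Prop) (A : Finset α)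
    (W : Finset ε) (h : ∀ e ∈ W, ∃ a ∈ A, R a e) :
    ∃ A' ⊆ A, (∀ e ∈ W, ∃ a ∈ A', R a e) ∧
      ∀ a ∈ A', ∃ e ∈ W, R a e ∧ ∀ a' ∈ A', R a' e → a' = a := by
  classical
  obtain ⟨P, hP⟩ : ∃ P : Finset α → Prop, ∀ B, P B ↔ ∀ e ∈ W, ∃ a ∈ B, R a e :=
    ⟨_, fun _ => Iff.rfl⟩
  obtain ⟨A', hA', hmin⟩ := Finset.exists_min_image (A.powerset.filter P) Finset.card
    ⟨A, Finset.mem_filter.2 ⟨Finset.mem_powerset_self A, (hP A).2 h⟩⟩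
  rw [Finset.mem_filter, Finset.mem_powerset, hP] at hA'
  refine ⟨A', hA'.1, hA'.2, fun a ha => ?_⟩
  by_contra! hno
  have hcov : ∀ e ∈ W, ∃ a' ∈ A'.erase a, R a' e := by
    intro e he
    obtain ⟨a₁, h1, h2⟩ := hA'.2 e he
    by_cases h3 : a₁ = a
    · subst h3
      obtain ⟨a₂, h4, h5, h6⟩ := hno e he h2
      exact ⟨a₂, Finset.mem_erase.2 ⟨h6, h4⟩, h5⟩
    · exact ⟨a₁, Finset.mem_erase.2 ⟨h3, h1⟩, h2⟩
  have := hmin (A'.erase a) (Finset.mem_filter.2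
    ⟨Finset.mem_powerset.2 ((Finset.erase_subset _ _).trans hA'.1), (hP _).2 hcov⟩)
  have := Finset.card_erase_lt_of_mem ha
  omega

open Classical in
/-- A chain of sets can be covered by chords such that no set of the laminar family is crossed by
more than four of them. -/
theorem exists_sparse_chain_cover {α β ε : Type*} (s t : α → β) (A : Finset α) (I : ε → Set β)
    (hlam : IsLaminar I) (W : Finset ε) (b : β) (hb : ∀ e ∈ W, b ∈ I e)
    (hcov : ∀ e ∈ W, ∃ a ∈ A, s a ∈ I e ∧ t a ∉ I e) :
    ∃ A' ⊆ A, (∀ e ∈ W, ∃ a ∈ A', s a ∈ I e ∧ t a ∉ I e) ∧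
      ∀ e, (A'.filter (fun a => s a ∈ I e ∧ t a ∉ I e)).card ≤ 2 ∧
        (A'.filter (fun a => t a ∈ I e ∧ s a ∉ I e)).card ≤ 2 := by
  obtain ⟨A', hA', hc, hpriv⟩ :=
    exists_minimal_cover (fun a e => s a ∈ I e ∧ t a ∉ I e) A W hcov
  refine ⟨A', hA', hc, ?_⟩
  rcases isEmpty_or_nonempty ε with hε | hε
  · exact fun e => hε.elim e
  choose! f hfW hf hfu using hpriv
  -- The sets in `W` share `b`, so laminarity makes them a chain; `κ` ranks a chord by the position
  -- of its private set in that chain.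
  let κ : α → ℕ := fun a => (W.filter (fun e => I e ⊆ I (f a))).card
  have hκ : ∀ a ∈ A', ∀ a' ∈ A', κ a ≤ κ a' → I (f a) ⊆ I (f a') := by
    intro a ha a' ha' hle
    rcases hlam (f a) (f a') ⟨b, hb _ (hfW a ha), hb _ (hfW a' ha')⟩ with h | h
    · exact h
    · by_contra hn
      have : κ a' < κ a := by
        apply Finset.card_lt_card
        refine (Finset.ssubset_iff_of_subset ?_).2 ⟨f a, ?_, ?_⟩
        · intro e he
          rw [Finset.mem_filter] at he ⊢
          exact ⟨he.1, he.2.trans h⟩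
        · exact Finset.mem_filter.2 ⟨hfW a ha, subset_rfl⟩
        · exact fun h' => hn (Finset.mem_filter.1 h').2
      omega
  -- A smaller chord does not leave a larger private set and a larger chord does not leave a smaller
  -- one, because private sets have only one covering chord.
  have hord : ∀ a ∈ A', ∀ a' ∈ A', a ≠ a' → κ a ≤ κ a' →
      I (f a) ⊆ I (f a') ∧ t a ∈ I (f a') ∧ s a' ∉ I (f a) := by
    intro a ha a' ha' hne hle
    have hsub := hκ a ha a' ha' hle
    refine ⟨hsub, ?_, ?_⟩
    · by_contra h
      exact hne (hfu a' ha' a ha ⟨hsub (hf a ha).1, h⟩)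
    · intro h
      exact hne (hfu a ha a' ha' ⟨h, fun h' => (hf a' ha').2 (hsub h')⟩).symm
  have htwo : ∀ X ⊆ A', (∀ a₁ ∈ X, ∀ a₂ ∈ X, ∀ a₃ ∈ X, a₂ ≠ a₁ → a₃ ≠ a₂ →
      κ a₂ ≤ κ a₁ → κ a₃ ≤ κ a₂ → False) → X.card ≤ 2 := by
    intro X _ hX
    rcases X.eq_empty_or_nonempty with rfl | hne
    · simp
    obtain ⟨a₁, h1, h1'⟩ := Finset.exists_max_image X κ hne
    obtain ⟨a₃, h3, h3'⟩ := Finset.exists_min_image X κ hne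
    refine (Finset.card_le_card (t := {a₁, a₃}) ?_).trans Finset.card_le_two
    intro a ha
    by_contra hn
    simp only [Finset.mem_insert, Finset.mem_singleton, not_or] at hn
    exact hX a₁ h1 a ha a₃ h3 hn.1 (Ne.symm hn.2) (h1' a ha) (h3' a ha)
  intro e
  constructor
  · refine htwo _ (Finset.filter_subset _ _) fun a₁ h1 a₂ h2 a₃ h3 h21 h32 hκ1 hκ2 => ?_
    rw [Finset.mem_filter] at h1 h2 h3
    have p := hord a₂ h2.1 a₁ h1.1 h21 hκ1
    have p' := hord a₃ h3.1 a₂ h2.1 h32 hκ2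
    rcases hlam e (f a₂) ⟨s a₃, h3.2.1, p'.1 (hf a₃ h3.1).1⟩ with h | h
    · exact p.2.2 (h h1.2.1)
    · exact h3.2.2 (h p'.2.1)
  · refine htwo _ (Finset.filter_subset _ _) fun a₁ h1 a₂ h2 a₃ h3 h21 h32 hκ1 hκ2 => ?_
    rw [Finset.mem_filter] at h1 h2 h3
    have p := hord a₂ h2.1 a₁ h1.1 h21 hκ1
    have p' := hord a₃ h3.1 a₂ h2.1 h32 hκ2
    rcases hlam e (f a₂) ⟨t a₃, h3.2.1, p'.2.1⟩ with h | h
    · exact (hf a₁ h1.1).2 (p.1 (h h1.2.1))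
    · exact h3.2.2 (h (p'.1 (hf a₃ h3.1).1))

theorem exists_sparse_chain_family {α β ε : Type*} (s t : α → β) (A : Finset α) (I : ε → Set β)
    (hlam : IsLaminar I) (W : Finset ε) (b : β) (hb : ∀ e ∈ W, b ∈ I e)
    (hcov : ∀ e ∈ W, ∃ a ∈ A, s a ∈ I e ∧ t a ∉ I e) :
    ∃ 𝓗, IsSparse s t A (Set.range I) 1 1 4 𝓗 ∧ ∀ e ∈ W, ∃ H ∈ 𝓗, parity s t (I e) H ≠ 0 := by
  classical
  obtain ⟨A', hA', h1, h2⟩ := exists_sparse_chain_cover s t A I hlam W b hb hcov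
  refine ⟨A'.image singleton, ⟨?_, ?_, ?_, ?_⟩, ?_⟩
  · intro H hH
    obtain ⟨a, ha, rfl⟩ := Finset.mem_image.1 hH
    simpa using hA' ha
  · intro H hH
    obtain ⟨a, ha, rfl⟩ := Finset.mem_image.1 hH
    simp
  · intro a
    refine Finset.card_le_one.2 fun H hH H' hH' => ?_
    rw [Finset.mem_filter] at hH hH'
    obtain ⟨x, _, rfl⟩ := Finset.mem_image.1 hH.1
    obtain ⟨y, _, rfl⟩ := Finset.mem_image.1 hH'.1
    rw [← Finset.mem_singleton.1 hH.2, ← Finset.mem_singleton.1 hH'.2]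
  · rintro _ ⟨e, rfl⟩
    rw [Finset.filter_image]
    refine Finset.card_image_le.trans ?_
    simp only [parity_singleton_ne_zero]
    rw [Finset.filter_or]
    exact (Finset.card_union_le _ _).trans (add_le_add (h2 e).1 (h2 e).2)
  · intro e he
    obtain ⟨a, ha, h⟩ := h1 e he
    exact ⟨{a}, Finset.mem_image_of_mem _ ha, parity_singleton_ne_zero.2 (Or.inl h)⟩

/-- The chords that cross a fixed position cover the intervals of a laminar family sparsely. -/
theorem exists_cover_of_crossing {α ε : Type*} (s t : α → ℕ) (q j b : ℕ) (A : Finset α)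
    (hq : A.card ≤ 2 ^ q) (hb : ∀ a ∈ A, s a < b ∧ b ≤ t a) (I : ε → Set ℕ) (hlam : IsLaminar I)
    (hI : ∀ e, (I e).OrdConnected) (W : Finset ε) (hj : W.card < 2 ^ j)
    (hW : ∀ e ∈ W, ∃ a ∈ A, parity s t (I e) {a} ≠ 0) :
    ∃ 𝓗, IsSparse s t A (Set.range I) (2 * (2 * q + 1)) (2 * (j + 1) + 2)
        (2 * (j * (32 * q + 5) + 1) + 8) 𝓗 ∧
      ∀ e ∈ W, ∃ H ∈ 𝓗, parity s t (I e) H ≠ 0 := by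
  classical
  have hrange : Set.range I ⊆ {I | I.OrdConnected} := by
    rintro _ ⟨e, rfl⟩
    exact hI e
  have hcard : ∀ (P : ε → Prop) [DecidablePred P], (W.filter P).card < 2 ^ j := fun P _ =>
    (Finset.card_filter_le _ _).trans_lt hj
  obtain ⟨𝓗₁, h1, k1⟩ := exists_cover_of_const s t q j A hq I
    (W.filter fun e => ∀ a ∈ A, ∀ a' ∈ A, t a ∈ I e ↔ t a' ∈ I e) (hcard _) (fun e _ => hI e)
    (fun e he => (Finset.mem_filter.1 he).2) (fun e he => hW e (Finset.mem_filter.1 he).1)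
  obtain ⟨𝓗₂, h2, k2⟩ := exists_cover_of_const t s q j A hq I
    (W.filter fun e => ∀ a ∈ A, ∀ a' ∈ A, s a ∈ I e ↔ s a' ∈ I e) (hcard _) (fun e _ => hI e)
    (fun e he => (Finset.mem_filter.1 he).2)
    (fun e he => by simpa only [parity_swap] using hW e (Finset.mem_filter.1 he).1)
  simp only [parity_swap] at k2
  obtain ⟨𝓗₃, h3, k3⟩ := exists_sparse_chain_family s t A I hlam
    (W.filter fun e => b ∈ I e ∧ ∃ a ∈ A, s a ∈ I e ∧ t a ∉ I e) b
    (fun e he => (Finset.mem_filter.1 he).2.1) (fun e he => (Finset.mem_filter.1 he).2.2)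
  obtain ⟨𝓗₄, h4, k4⟩ := exists_sparse_chain_family t s A I hlam
    (W.filter fun e => b ∈ I e ∧ ∃ a ∈ A, t a ∈ I e ∧ s a ∉ I e) b
    (fun e he => (Finset.mem_filter.1 he).2.1) (fun e he => (Finset.mem_filter.1 he).2.2)
  simp only [parity_swap] at k4
  have g1 := h1.mono subset_rfl hrange le_rfl le_rfl le_rfl
  have g2 := h2.swap.mono subset_rfl hrange le_rfl le_rfl le_rfl
  have g3 := h3.mono (ℓ' := 2 * (2 * q + 1)) subset_rfl subset_rfl (by omega) le_rfl le_rfl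
  have g4 := h4.swap.mono (ℓ' := 2 * (2 * q + 1)) subset_rfl subset_rfl (by omega) le_rfl le_rfl
  refine ⟨(𝓗₁ ∪ 𝓗₂) ∪ (𝓗₃ ∪ 𝓗₄), ((g1.union g2).union (g3.union g4)).mono subset_rfl subset_rfl
    le_rfl (by omega) (by omega), fun e he => ?_⟩
  have lift : ∀ 𝓗 ⊆ (𝓗₁ ∪ 𝓗₂) ∪ (𝓗₃ ∪ 𝓗₄), (∃ H ∈ 𝓗, parity s t (I e) H ≠ 0) →
      ∃ H ∈ (𝓗₁ ∪ 𝓗₂) ∪ (𝓗₃ ∪ 𝓗₄), parity s t (I e) H ≠ 0 :=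
    fun 𝓗 hs ⟨H, hH, h⟩ => ⟨H, hs hH, h⟩
  by_cases c1 : ∀ a ∈ A, ∀ a' ∈ A, t a ∈ I e ↔ t a' ∈ I e
  · exact lift 𝓗₁ (by intro x hx; simp [hx]) (k1 e (Finset.mem_filter.2 ⟨he, c1⟩))
  by_cases c2 : ∀ a ∈ A, ∀ a' ∈ A, s a ∈ I e ↔ s a' ∈ I e
  · exact lift 𝓗₂ (by intro x hx; simp [hx]) (k2 e (Finset.mem_filter.2 ⟨he, c2⟩))
  -- Here `I e` contains a left end and a right end, hence by convexity the position `b` between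
  -- them, and the chain families apply.
  have hbI : b ∈ I e := by
    obtain ⟨y, hy, hyI⟩ : ∃ y ∈ A, t y ∈ I e := by
      by_contra! hno
      exact c1 fun a ha a' ha' => by simp [hno a ha, hno a' ha']
    obtain ⟨x, hx, hxI⟩ : ∃ x ∈ A, s x ∈ I e := by
      by_contra! hno
      exact c2 fun a ha a' ha' => by simp [hno a ha, hno a' ha']
    exact (hI e).out hxI hyI ⟨(hb x hx).1.le, (hb y hy).2⟩
  obtain ⟨a, ha, hodd⟩ := hW e he
  rcases parity_singleton_ne_zero.1 hodd with h | h
  · exact lift 𝓗₃ (by intro x hx; simp [hx]) (k3 e (Finset.mem_filter.2 ⟨he, hbI, a, ha, h⟩))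
  · exact lift 𝓗₄ (by intro x hx; simp [hx]) (k4 e (Finset.mem_filter.2 ⟨he, hbI, a, ha, h⟩))

-- A chord set odd on `I` contains a chord that crosses `I`, so only the classes with a crossing
-- chord add to the count for `I`.
open Classical in
theorem isSparse_biUnion {α β κ : Type*} {s t : α → β} {𝓘 : Set (Set β)} {ℓ c d m m' : ℕ}
    (A : Finset α) (K : Finset κ) (B : κ → Finset α) (𝓗 : κ → Finset (Finset α))
    (hB : ∀ x ∈ K, B x ⊆ A) (h : ∀ x ∈ K, IsSparse s t (B x) 𝓘 ℓ c d (𝓗 x))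
    (hm : ∀ a, (K.filter (fun x => a ∈ B x)).card ≤ m)
    (hm' : ∀ I ∈ 𝓘, (K.filter (fun x => ∃ a ∈ B x, parity s t I {a} ≠ 0)).card ≤ m') :
    IsSparse s t A 𝓘 ℓ (m * c) (m' * d) (K.biUnion 𝓗) := by
  refine ⟨?_, ?_, fun a => ?_, fun I hI => ?_⟩
  · intro H hH
    obtain ⟨x, hx, hH⟩ := Finset.mem_biUnion.1 hH
    exact ((h x hx).subset H hH).trans (hB x hx)
  · intro H hH
    obtain ⟨x, hx, hH⟩ := Finset.mem_biUnion.1 hH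
    exact (h x hx).card_le H hH
  · have hsub : (K.biUnion 𝓗).filter (fun H => a ∈ H) ⊆
        (K.filter (fun x => a ∈ B x)).biUnion fun x => (𝓗 x).filter (fun H => a ∈ H) := by
      intro H hH
      rw [Finset.mem_filter, Finset.mem_biUnion] at hH
      obtain ⟨⟨x, hx, hH⟩, ha⟩ := hH
      exact Finset.mem_biUnion.2 ⟨x, Finset.mem_filter.2 ⟨hx, (h x hx).subset H hH ha⟩,
        Finset.mem_filter.2 ⟨hH, ha⟩⟩
    refine (Finset.card_le_card hsub).trans ((Finset.card_biUnion_le_card_mul _ _ c ?_).trans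
      (Nat.mul_le_mul_right c (hm a)))
    exact fun x hx => (h x (Finset.mem_filter.1 hx).1).chord_le a
  · have hsub : (K.biUnion 𝓗).filter (fun H => parity s t I H ≠ 0) ⊆
        (K.filter (fun x => ∃ a ∈ B x, parity s t I {a} ≠ 0)).biUnion
          fun x => (𝓗 x).filter (fun H => parity s t I H ≠ 0) := by
      intro H hH
      rw [Finset.mem_filter, Finset.mem_biUnion] at hH
      obtain ⟨⟨x, hx, hH⟩, hodd⟩ := hH
      obtain ⟨a, ha, h'⟩ := exists_of_parity_ne_zero hodd
      exact Finset.mem_biUnion.2 ⟨x, Finset.mem_filter.2 ⟨hx, a, (h x hx).subset H hH ha,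
        parity_singleton_ne_zero.2 h'⟩, Finset.mem_filter.2 ⟨hH, hodd⟩⟩
    refine (Finset.card_le_card hsub).trans ((Finset.card_biUnion_le_card_mul _ _ d ?_).trans
      (Nat.mul_le_mul_right d (hm' I hI)))
    exact fun x hx => (h x (Finset.mem_filter.1 hx).1).cut_le I hI

/-- Two distinct positions below `2 ^ k` are separated by the midpoint of a unique dyadic block. -/
theorem exists_dyadic_split (k x y : ℕ) (hx : x < 2 ^ k) (hy : y < 2 ^ k) (hxy : x < y) :
    ∃ i < k, x / 2 ^ (i + 1) = y / 2 ^ (i + 1) ∧ x / 2 ^ i < y / 2 ^ i := by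
  have hex : ∃ i, x / 2 ^ i = y / 2 ^ i := ⟨k, by rw [Nat.div_eq_of_lt hx, Nat.div_eq_of_lt hy]⟩
  classical
  have h0 : Nat.find hex ≠ 0 := by
    intro h
    have := Nat.find_spec hex
    rw [h] at this
    simp at this
    omega
  obtain ⟨i, hi⟩ := Nat.exists_eq_succ_of_ne_zero h0
  have hik : Nat.find hex ≤ k :=
    Nat.find_min' hex (by rw [Nat.div_eq_of_lt hx, Nat.div_eq_of_lt hy])
  have hspec := Nat.find_spec hex
  rw [hi] at hspec hik
  refine ⟨i, by omega, hspec, lt_of_le_of_ne (Nat.div_le_div_right hxy.le) ?_⟩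
  exact Nat.find_min hex (by omega)

/-- Chords are classified by the level `i` and the index `l` of the dyadic block whose midpoint `(2
* l + 1) * 2 ^ i` separates their ends. A chord belongs to at most one class per level. An interval
crossed by a chord of a class splits its block, which happens for at most two blocks per level;
hence the factors `k` and `2 * k`. -/
theorem exists_cover_of_lt {α ε : Type*} (s t : α → ℕ) (k q j : ℕ) (A : Finset α)
    (hq : A.card ≤ 2 ^ q) (hst : ∀ a ∈ A, s a < t a) (hk : ∀ a ∈ A, t a < 2 ^ k)
    (I : ε → Set ℕ) (hlam : IsLaminar I)
    (hI : ∀ e, (I e).OrdConnected) (W : Finset ε) (hj : W.card < 2 ^ j)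
    (hW : ∀ e ∈ W, ∃ a ∈ A, parity s t (I e) {a} ≠ 0) :
    ∃ 𝓗, IsSparse s t A (Set.range I) (2 * (2 * q + 1)) (k * (2 * (j + 1) + 2))
        ((2 * k) * (2 * (j * (32 * q + 5) + 1) + 8)) 𝓗 ∧
      ∀ e ∈ W, ∃ H ∈ 𝓗, parity s t (I e) H ≠ 0 := by
  classical
  let K : Finset (ℕ × ℕ) := Finset.range k ×ˢ Finset.range (2 ^ k)
  let B : ℕ × ℕ → Finset α := fun x => A.filter fun a => s a / 2 ^ (x.1 + 1) = x.2 ∧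
    t a / 2 ^ (x.1 + 1) = x.2 ∧ s a / 2 ^ x.1 < t a / 2 ^ x.1
  have hBA : ∀ x, B x ⊆ A := fun x => Finset.filter_subset _ _
  have hcross : ∀ x, ∀ a ∈ B x, s a < (2 * x.2 + 1) * 2 ^ x.1 ∧ (2 * x.2 + 1) * 2 ^ x.1 ≤ t a := by
    rintro ⟨i, l⟩ a ha
    simp only [B, Finset.mem_filter] at ha
    obtain ⟨_, h1, h2, h3⟩ := ha
    rw [pow_succ, ← Nat.div_div_eq_div_mul] at h1 h2
    have hpos : 0 < 2 ^ i := by positivity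
    exact ⟨(Nat.div_lt_iff_lt_mul hpos).1 (by omega), (Nat.le_div_iff_mul_le hpos).1 (by omega)⟩
  have hloc : ∀ x : ℕ × ℕ, ∃ 𝓗, IsSparse s t (B x) (Set.range I) (2 * (2 * q + 1))
      (2 * (j + 1) + 2) (2 * (j * (32 * q + 5) + 1) + 8) 𝓗 ∧
      ∀ e ∈ W.filter (fun e => ∃ a ∈ B x, parity s t (I e) {a} ≠ 0),
        ∃ H ∈ 𝓗, parity s t (I e) H ≠ 0 := fun x =>
    exists_cover_of_crossing s t q j _ (B x) ((Finset.card_le_card (hBA x)).trans hq) (hcross x) I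
      hlam hI _ ((Finset.card_filter_le _ _).trans_lt hj) (fun e he => (Finset.mem_filter.1 he).2)
  choose 𝓗 h1 h2 using hloc
  refine ⟨K.biUnion 𝓗, isSparse_biUnion A K B 𝓗 (fun x _ => hBA x) (fun x _ => h1 x) ?_ ?_, ?_⟩
  · intro a
    refine (Finset.card_le_card_of_injOn (t := Finset.range k) Prod.fst ?_ ?_).trans (by simp)
    · intro x hx
      have hx' := (Finset.mem_filter.1 (Finset.mem_coe.1 hx)).1
      exact (Finset.mem_product.1 hx').1
    · rintro ⟨i, l⟩ hx ⟨i', l'⟩ hx' (rfl : i = i')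
      have h1 := (Finset.mem_filter.1 (Finset.mem_filter.1 (Finset.mem_coe.1 hx)).2).2.1
      have h2 := (Finset.mem_filter.1 (Finset.mem_filter.1 (Finset.mem_coe.1 hx')).2).2.1
      simp only at h1 h2
      rw [← h1, ← h2]
  · rintro _ ⟨e, rfl⟩
    have hmaps : ∀ x ∈ K.filter (fun x => ∃ a ∈ B x, parity s t (I e) {a} ≠ 0),
        x.1 ∈ Finset.range k := fun x hx =>
      (Finset.mem_product.1 (Finset.mem_filter.1 hx).1).1
    refine (Finset.card_le_mul_card_image_of_maps_to hmaps 2 fun i _ => ?_).trans (by simp)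
    rw [← Finset.card_image_of_injOn (f := Prod.snd)]
    · have : ∀ l ∈ ((K.filter (fun x => ∃ a ∈ B x, parity s t (I e) {a} ≠ 0)).filter
          (fun x => x.1 = i)).image Prod.snd, ∃ x y, x ∈ I e ∧ y ∉ I e ∧
            x / 2 ^ (i + 1) = l ∧ y / 2 ^ (i + 1) = l := by
        intro l hl
        obtain ⟨⟨i', l'⟩, hx, rfl⟩ := Finset.mem_image.1 hl
        rw [Finset.mem_filter] at hx
        obtain ⟨hx, rfl⟩ := hx
        obtain ⟨a, ha, hodd⟩ := (Finset.mem_filter.1 hx).2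
        have hB := (Finset.mem_filter.1 ha).2
        rcases parity_singleton_ne_zero.1 hodd with h | h
        · exact ⟨_, _, h.1, h.2, hB.1, hB.2.1⟩
        · exact ⟨_, _, h.1, h.2, hB.2.1, hB.1⟩
      choose! p r hp using this
      refine card_split_le_two (hI e) _ p r (fun l hl => (hp l hl).1) (fun l hl => (hp l hl).2.1)
        fun l hl l' hl' hlt => ?_
      obtain ⟨_, _, a1, a2⟩ := hp l hl
      obtain ⟨_, _, b1, b2⟩ := hp l' hl'
      constructor
      · by_contra! hc
        have := Nat.div_le_div_right (c := 2 ^ (i + 1)) hc.le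
        omega
      · by_contra! hc
        have := Nat.div_le_div_right (c := 2 ^ (i + 1)) hc.le
        omega
    · rintro ⟨i₁, l₁⟩ hx₁ ⟨i₂, l₂⟩ hx₂ (rfl : l₁ = l₂)
      have e1 := (Finset.mem_filter.1 (Finset.mem_coe.1 hx₁)).2
      have e2 := (Finset.mem_filter.1 (Finset.mem_coe.1 hx₂)).2
      simp only at e1 e2
      rw [e1, e2]
  · intro e he
    obtain ⟨a, ha, hodd⟩ := hW e he
    obtain ⟨i, hi, g1, g2⟩ := exists_dyadic_split k (s a) (t a)
      ((hst a ha).trans (hk a ha)) (hk a ha) (hst a ha)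
    obtain ⟨H, hH, h⟩ := h2 (i, s a / 2 ^ (i + 1)) e (Finset.mem_filter.2
      ⟨he, a, Finset.mem_filter.2 ⟨ha, rfl, g1.symm, g2⟩, hodd⟩)
    refine ⟨H, Finset.mem_biUnion.2 ⟨_, ?_, hH⟩, h⟩
    refine Finset.mem_product.2 ⟨Finset.mem_range.2 hi, Finset.mem_range.2 ?_⟩
    exact (Nat.div_le_self _ _).trans_lt ((hst a ha).trans (hk a ha))

/-- **Sparse covers of laminar interval families.** Given polynomially many chords on a line and a
laminar family of intervals, there are small sets of chords that cover all chords, are odd on each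
interval that is crossed by a chord, and whose congestion is polylogarithmic. -/
theorem exists_sparse_cover {α ε : Type*} (s t : α → ℕ) (q : ℕ) (h1 : 1 ≤ q) (A : Finset α)
    (hq : A.card ≤ 2 ^ q) (hs : ∀ a ∈ A, s a < 2 ^ q) (ht : ∀ a ∈ A, t a < 2 ^ q)
    (I : ε → Set ℕ) (hlam : IsLaminar I) (hI : ∀ e, (I e).OrdConnected) (W : Finset ε)
    (hj : W.card < 2 ^ q) (hW : ∀ e ∈ W, ∃ a ∈ A, parity s t (I e) {a} ≠ 0) :
    ∃ 𝓗, IsSparse s t A (Set.range I) (6 * q) (9 * q ^ 2) (351 * q ^ 3) 𝓗 ∧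
      (∀ a ∈ A, ∃ H ∈ 𝓗, a ∈ H) ∧ ∀ e ∈ W, ∃ H ∈ 𝓗, parity s t (I e) H ≠ 0 := by
  classical
  -- Parity ignores orientation, so chords may be directed upwards; a chord with coinciding ends is
  -- even on everything and can be dropped here.
  have hpar : ∀ J : Set ℕ, ∀ H : Finset α,
      parity (fun a => min (s a) (t a)) (fun a => max (s a) (t a)) J H = parity s t J H := by
    intro J H
    refine Finset.sum_congr rfl fun a _ => ?_
    rcases le_total (s a) (t a) with h | h
    · simp [h]
    · simp [h, add_comm]
  obtain ⟨𝓗, g1, g2⟩ := exists_cover_of_lt (fun a => min (s a) (t a)) (fun a => max (s a) (t a))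
    q q q (A.filter fun a => s a ≠ t a) ((Finset.card_filter_le _ _).trans hq)
    (fun a ha => by
      have := (Finset.mem_filter.1 ha).2
      simp only [lt_sup_iff, inf_lt_iff]
      omega)
    (fun a ha => max_lt (hs a (Finset.mem_filter.1 ha).1) (ht a (Finset.mem_filter.1 ha).1))
    I hlam hI W hj (fun e he => by
      obtain ⟨a, ha, hodd⟩ := hW e he
      refine ⟨a, Finset.mem_filter.2 ⟨ha, fun h => hodd ?_⟩, by rwa [hpar]⟩
      rw [parity, Finset.sum_singleton, h, zmod_two_add_self])
  simp only [hpar] at g2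
  -- The first family need not contain every chord; a closing partition does.
  obtain ⟨𝓗', c1, c2, c3, c4⟩ := exists_closing_partition s t q q A hq hq
  have hg : IsSparse s t A (Set.range I) (2 * (2 * q + 1)) (q * (2 * (q + 1) + 2))
      ((2 * q) * (2 * (q * (32 * q + 5) + 1) + 8)) 𝓗 :=
    ⟨fun H hH => (g1.subset H hH).trans (Finset.filter_subset _ _), g1.card_le, g1.chord_le,
      fun J hJ => by simpa only [hpar] using g1.cut_le J hJ⟩
  have hc : IsSparse s t A (Set.range I) (2 * (2 * q + 1)) 1 (32 * q + 3) 𝓗' := by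
    refine ⟨fun H hH => (c1 H hH).1, fun H hH => (c1 H hH).2.2.trans (by omega), fun a => ?_, ?_⟩
    · refine Finset.card_le_one.2 fun H hH H' hH' => ?_
      rw [Finset.mem_filter] at hH hH'
      by_contra hne
      exact Finset.disjoint_left.1 (c2 hH.1 hH'.1 hne) hH.2 hH'.2
    · rintro _ ⟨e, rfl⟩
      exact c4 _ (hI e)
  refine ⟨𝓗 ∪ 𝓗', (hg.union hc).mono subset_rfl subset_rfl (by omega) ?_ ?_, ?_, ?_⟩
  · nlinarith
  · have h2 : q ≤ q ^ 2 := by nlinarith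
    have h3 : q ^ 2 ≤ q ^ 3 := by nlinarith [sq_nonneg q]
    have : 2 * q * (2 * (q * (32 * q + 5) + 1) + 8) + (32 * q + 3) =
      128 * q ^ 3 + 20 * q ^ 2 + 52 * q + 3 := by ring
    omega
  · intro a ha
    rw [← c3] at ha
    obtain ⟨H, hH, haH⟩ := Finset.mem_biUnion.1 ha
    exact ⟨H, Finset.mem_union_right _ hH, haH⟩
  · intro e he
    obtain ⟨H, hH, h⟩ := g2 e he
    exact ⟨H, Finset.mem_union_left _ hH, h⟩

end CycleCover

/-! ### Rooted trees as interval systems, and tree paths in the cycle space -/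

namespace CycleCover

open Finset

/-- The words with a given prefix are order-convex in the lexicographic order; this is why subtrees
become intervals. -/
theorem prefix_of_not_lt_of_not_lt {β : Type*} [LinearOrder β] (p l m l' : List β) (h1 : p <+: l)
    (h2 : p <+: l') (a : ¬ m < l) (b : ¬ l' < m) : p <+: m := by
  induction p generalizing l m l' with
  | nil => simp
  | cons x p ih =>
    obtain ⟨l, rfl⟩ := h1
    obtain ⟨l', rfl⟩ := h2
    cases m with
    | nil => simp at a
    | cons y m =>
      simp only [List.cons_append, List.cons_lt_cons_iff, not_or, not_and] at a b
      have hxy : x = y := le_antisymm (not_lt.1 a.1) (not_lt.1 b.1)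
      subst hxy
      rw [List.cons_prefix_cons]
      exact ⟨rfl, ih _ _ _ (List.prefix_append _ _) (List.prefix_append _ _) (a.2 rfl) (b.2 rfl)⟩

/-- The subtrees of a rooted tree, encoded by the root paths `c v`, become a laminar family of
intervals when the vertices are put in preorder. -/
theorem exists_preorder {V : Type*} [Fintype V] (c : V → List V)
    (h1 : ∀ v w, v ∈ c w → c v <+: c w) (h2 : ∀ v w, v ∈ c w → v ∈ c v) :
    ∃ (pos : V → ℕ) (I : V → Set ℕ), (∀ v, pos v < Fintype.card V) ∧
      (∀ v, (I v).OrdConnected) ∧ IsLaminar I ∧ ∀ v w, pos w ∈ I v ↔ v ∈ c w := by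
  classical
  let _ : LinearOrder V := LinearOrder.lift' (Fintype.equivFin V) (Fintype.equivFin V).injective
  -- Preorder rank by lexicographic comparison of root paths, for an arbitrary order on `V`.
  -- Vertices with equal paths share a position.
  let pos : V → ℕ := fun w => (Finset.univ.filter fun w' => c w' < c w).card
  have hpos : ∀ a b, pos a ≤ pos b → ¬ c b < c a := by
    intro a b hab hlt
    refine absurd hab (not_le.2 (Finset.card_lt_card
      ((Finset.ssubset_iff_of_subset ?_).2 ⟨b, ?_, ?_⟩)))
    · intro w hw
      rw [Finset.mem_filter] at hw ⊢
      exact ⟨hw.1, lt_trans hw.2 hlt⟩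
    · exact Finset.mem_filter.2 ⟨Finset.mem_univ _, hlt⟩
    · simp
  have hmem : ∀ v w, c v <+: c w → v ∈ c v → v ∈ c w := fun v w h h' => h.subset h'
  have hconv : ∀ v a x b, v ∈ c a → v ∈ c b → pos a ≤ pos x → pos x ≤ pos b → v ∈ c x := by
    intro v a x b ha hb hax hxb
    exact hmem v x (prefix_of_not_lt_of_not_lt (c v) (c a) (c x) (c b) (h1 v a ha) (h1 v b hb)
      (hpos a x hax) (hpos x b hxb)) (h2 v a ha)
  let I : V → Set ℕ := fun v => {n | ∃ a b, v ∈ c a ∧ v ∈ c b ∧ pos a ≤ n ∧ n ≤ pos b}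
  refine ⟨pos, I, fun v => ?_, fun v => ⟨?_⟩, ?_, fun v w => ⟨?_, ?_⟩⟩
  · refine Finset.card_lt_univ_of_notMem (x := v) ?_
    simp
  · rintro x ⟨a, _, ha, _, hax, _⟩ y ⟨_, b, _, hb, _, hyb⟩ z ⟨hxz, hzy⟩
    exact ⟨a, b, ha, hb, hax.trans hxz, hzy.trans hyb⟩
  · rintro v v' ⟨n, ⟨a, b, ha, hb, han, hnb⟩, ⟨a', b', ha', hb', han', hnb'⟩⟩
    -- Two hulls that meet share a descendant `w`, and two prefixes of the path of `w` are
    -- comparable.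
    obtain ⟨w, hw, hw'⟩ : ∃ w, v ∈ c w ∧ v' ∈ c w := by
      rcases le_total (pos a) (pos a') with h | h
      · exact ⟨a', hconv v a a' b ha hb h (han'.trans hnb), ha'⟩
      · exact ⟨a, ha, hconv v' a' a b' ha' hb' h (han.trans hnb')⟩
    have key : ∀ v v', v ∈ c v → c v <+: c v' → I v' ⊆ I v := by
      rintro v v' hv hp m ⟨x, y, hx, hy, hxm, hmy⟩
      exact ⟨x, y, hmem v x (hp.trans (h1 v' x hx)) hv, hmem v y (hp.trans (h1 v' y hy)) hv,
        hxm, hmy⟩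
    rcases List.prefix_or_prefix_of_prefix (h1 v w hw) (h1 v' w hw') with h | h
    · exact Or.inr (key v v' (h2 v w hw) h)
    · exact Or.inl (key v' v (h2 v' w hw') h)
  · rintro ⟨a, b, ha, hb, haw, hwb⟩
    exact hconv v a w b ha hb haw hwb
  · exact fun h => ⟨w, w, h, h, le_rfl, le_rfl⟩

section RootPath

variable {V : Type*} (par : V → V) (dep : V → ℕ)

/-- The path of length `n` that leads to `v` from its `n`-th ancestor, without its first vertex. -/
def ancestorPath : ℕ → V → List V
  | 0, _ => []
  | n + 1, v => ancestorPath n (par v) ++ [v]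

/-- The path from the root to `v`, without the root. -/
def rootPath (v : V) : List V := ancestorPath par (dep v) v

variable {par dep}

theorem rootPath_of_dep_eq_zero {v : V} (h : dep v = 0) : rootPath par dep v = [] := by
  rw [rootPath, h, ancestorPath]

variable (hpar : ∀ v, 0 < dep v → dep (par v) + 1 = dep v)
include hpar

theorem rootPath_of_pos {v : V} (h : 0 < dep v) :
    rootPath par dep v = rootPath par dep (par v) ++ [v] := by
  rw [rootPath, ← hpar v h, ancestorPath, rootPath]

theorem dep_of_mem_rootPath {v w : V} (h : v ∈ rootPath par dep w) :
    0 < dep v ∧ dep v ≤ dep w := by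
  induction hn : dep w generalizing w with
  | zero => simp [rootPath_of_dep_eq_zero hn] at h
  | succ n ih =>
    rw [rootPath_of_pos hpar (by omega), List.mem_append, List.mem_singleton] at h
    have := hpar w (by omega)
    rcases h with h | rfl
    · have := ih h (by omega)
      omega
    · omega

theorem self_mem_rootPath {v : V} (h : 0 < dep v) : v ∈ rootPath par dep v := by
  simp [rootPath_of_pos hpar h]

theorem rootPath_prefix {v w : V} (h : v ∈ rootPath par dep w) :
    rootPath par dep v <+: rootPath par dep w := by
  induction hn : dep w generalizing w with
  | zero => simp [rootPath_of_dep_eq_zero hn] at h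
  | succ n ih =>
    have := hpar w (by omega)
    rw [rootPath_of_pos hpar (by omega), List.mem_append, List.mem_singleton] at h
    rcases h with h | rfl
    · rw [rootPath_of_pos hpar (v := w) (by omega)]
      exact (ih h (by omega)).trans (List.prefix_append _ _)
    · exact List.prefix_rfl

theorem length_rootPath (v : V) : (rootPath par dep v).length = dep v := by
  induction hn : dep v generalizing v with
  | zero => simp [rootPath_of_dep_eq_zero hn]
  | succ n ih =>
    have := hpar v (by omega)
    rw [rootPath_of_pos hpar (by omega), List.length_append, ih _ (by omega)]
    rfl

theorem eq_of_treeEdge_eq {v w : V} (hv : 0 < dep v) (hw : 0 < dep w)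
    (h : s(par v, v) = s(par w, w)) : v = w := by
  rw [Sym2.eq_iff] at h
  rcases h with h | h
  · exact h.2
  · have h1 := hpar v hv
    have h2 := hpar w hw
    rw [h.1] at h1
    rw [← h.2] at h2
    omega

end RootPath

/-- The value of the cut functional of `g` on an edge. -/
def cut {V : Type*} (g : V → ZMod 2) : Sym2 V → ZMod 2 :=
  Sym2.lift ⟨fun x y => g x + g y, fun _ _ => add_comm _ _⟩

@[simp]
theorem cut_mk {V : Type*} (g : V → ZMod 2) (x y : V) : cut g s(x, y) = g x + g y := rfl

open Classical in
/-- A family of small elements of the cycle space of `G` that covers `F` with congestion `c`. -/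
structure IsClosedFamily {V : Type*} [Fintype V] (G : SimpleGraph V) (ℓ c : ℕ)
    (F : Finset (Sym2 V)) (𝓩 : Finset (Sym2 V → ZMod 2)) : Prop where
  closed : ∀ Z ∈ 𝓩, ∀ g : V → ZMod 2, ∑ e, Z e * cut g e = 0
  mem_edgeSet : ∀ Z ∈ 𝓩, ∀ e, Z e ≠ 0 → e ∈ G.edgeSet
  card_le : ∀ Z ∈ 𝓩, (Finset.univ.filter fun e => Z e ≠ 0).card ≤ ℓ
  congestion_le : ∀ e, (𝓩.filter fun Z => Z e ≠ 0).card ≤ c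
  covers : ∀ e ∈ F, ∃ Z ∈ 𝓩, Z e ≠ 0

section TreeVector

variable {V : Type*} [DecidableEq V] (par : V → V) (dep : V → ℕ)

/-- The edge set of the tree path from the root to `w`. -/
noncomputable def treeVector (w : V) : Sym2 V → ZMod 2 :=
  ∑ v ∈ (rootPath par dep w).toFinset, Pi.single s(par v, v) 1

variable {par dep}

theorem treeVector_apply_of_ne (w : V) (e : Sym2 V) (h : ∀ v, 0 < dep v → e ≠ s(par v, v))
    (hpar : ∀ v, 0 < dep v → dep (par v) + 1 = dep v) :
    treeVector par dep w e = 0 := by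
  rw [treeVector, Finset.sum_apply]
  refine Finset.sum_eq_zero fun v hv => ?_
  exact Pi.single_eq_of_ne (h v (dep_of_mem_rootPath hpar (List.mem_toFinset.1 hv)).1) _

variable (hpar : ∀ v, 0 < dep v → dep (par v) + 1 = dep v)
include hpar

theorem treeVector_apply (w v : V) (hv : 0 < dep v) :
    treeVector par dep w s(par v, v) = if v ∈ rootPath par dep w then 1 else 0 := by
  rw [treeVector, Finset.sum_apply]
  split_ifs with h
  · rw [Finset.sum_eq_single_of_mem v (List.mem_toFinset.2 h), Pi.single_eq_same]
    intro v' hv' hne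
    refine Pi.single_eq_of_ne (fun heq => hne ?_) _
    exact (eq_of_treeEdge_eq hpar hv
      (dep_of_mem_rootPath hpar (List.mem_toFinset.1 hv')).1 heq).symm
  · refine Finset.sum_eq_zero fun v' hv' => ?_
    refine Pi.single_eq_of_ne (fun heq => h ?_) _
    rw [List.mem_toFinset] at hv'
    rwa [eq_of_treeEdge_eq hpar hv (dep_of_mem_rootPath hpar hv').1 heq]

theorem treeVector_of_pos {w : V} (hw : 0 < dep w) :
    treeVector par dep w = treeVector par dep (par w) + Pi.single s(par w, w) 1 := by
  have hnot : w ∉ (rootPath par dep (par w)).toFinset := by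
    intro h
    have := dep_of_mem_rootPath hpar (List.mem_toFinset.1 h)
    have := hpar w hw
    omega
  have : (rootPath par dep w).toFinset = insert w (rootPath par dep (par w)).toFinset := by
    rw [rootPath_of_pos hpar hw]
    ext x
    simp
  rw [treeVector, this, Finset.sum_insert hnot, add_comm, treeVector]

theorem card_support_treeVector_le [Fintype V] (w : V) :
    (Finset.univ.filter fun e => treeVector par dep w e ≠ 0).card ≤ dep w := by
  rw [← length_rootPath hpar w]
  refine (Finset.card_le_card
    (t := (rootPath par dep w).toFinset.image fun v => s(par v, v)) ?_).trans
    (Finset.card_image_le.trans (List.toFinset_card_le (rootPath par dep w)))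
  intro e he
  rw [Finset.mem_filter] at he
  by_contra hno
  refine he.2 ?_
  rw [treeVector, Finset.sum_apply]
  refine Finset.sum_eq_zero fun v hv => Pi.single_eq_of_ne (fun h => hno ?_) _
  exact Finset.mem_image.2 ⟨v, hv, h.symm⟩

end TreeVector

theorem sum_single_mul {ι : Type*} [Fintype ι] [DecidableEq ι] (a : ι) (f : ι → ZMod 2) :
    ∑ e, (Pi.single a 1 : ι → ZMod 2) e * f e = f a := by
  rw [Finset.sum_eq_single a]
  · simp
  · intro b _ hb
    simp [Pi.single_eq_of_ne hb]
  · simp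

theorem exists_parent {V : Type*} (G : SimpleGraph V) (u v : V) (h : 0 < G.dist u v) :
    ∃ w, G.Adj w v ∧ G.dist u w + 1 = G.dist u v ∧ G.Reachable u w := by
  have hr : G.Reachable u v := SimpleGraph.Reachable.of_dist_ne_zero (by omega)
  obtain ⟨p, hp⟩ := hr.symm.exists_walk_length_eq_dist
  rw [SimpleGraph.dist_comm] at hp
  cases p with
  | nil => simp at h
  | @cons _ w _ hadj p =>
    have h1 : G.dist u w ≤ p.length := by
      rw [SimpleGraph.dist_comm]
      exact SimpleGraph.dist_le p
    have h2 := hadj.symm.diff_dist_adj (u := u)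
    rw [SimpleGraph.Walk.length_cons] at hp
    exact ⟨w, hadj.symm, by omega, p.reachable.symm⟩

end CycleCover

/-! ### Covering graphs of small radius -/

namespace CycleCover

open Finset

/-- **Covering a low-diameter graph.** All edges of `G` that are not bridges can be covered by small
elements of the cycle space with polylogarithmic congestion. -/
theorem exists_closedFamily_of_radius {V : Type*} [Fintype V] (G : SimpleGraph V) (u : V)
    (R q : ℕ) (hq : 1 ≤ q) (hcard : Fintype.card (Sym2 V) < 2 ^ q) (hV : Fintype.card V < 2 ^ q)
    (hR : ∀ v w, G.Adj v w → ∃ p : G.Walk u v, p.length ≤ R) (F : Finset (Sym2 V))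
    (hF : ∀ e ∈ F, e ∈ G.edgeSet ∧ ¬ G.IsBridge e) :
    ∃ 𝓩, IsClosedFamily G (6 * q * (2 * R + 1)) (351 * q ^ 3) F 𝓩 := by
  classical
  -- Vertices not reachable from `u` also get depth `0` and so an empty root path; by `hR` they
  -- carry no edges.
  set dep : V → ℕ := G.dist u with hdep
  choose! par hpar using exists_parent G u
  have hpd : ∀ v, 0 < dep v → dep (par v) + 1 = dep v := fun v hv => (hpar v hv).2.1
  obtain ⟨pos, I, hposlt, hI, hlam, hmem⟩ := exists_preorder (rootPath par dep)
    (fun v w h => rootPath_prefix hpd h)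
    (fun v w h => self_mem_rootPath hpd (dep_of_mem_rootPath hpd h).1)
  have hreach : ∀ v w, G.Adj v w → G.Reachable u v ∧ dep v ≤ R := fun v w h => by
    obtain ⟨p, hp⟩ := hR v w h
    exact ⟨p.reachable, (SimpleGraph.dist_le p).trans hp⟩
  have hpair : ∀ v, G.Reachable u v → ∀ g : V → ZMod 2,
      ∑ e, treeVector par dep v e * cut g e = g v + g u := by
    intro v
    induction hn : dep v generalizing v with
    | zero =>
      intro hr g
      have : u = v := by
        rcases SimpleGraph.dist_eq_zero_iff_eq_or_not_reachable.1 hn with h | h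
        · exact h
        · exact absurd hr h
      subst this
      rw [zmod_two_add_self, treeVector, rootPath_of_dep_eq_zero hn]
      simp
    | succ n ih =>
      intro hr g
      have hv : 0 < dep v := by omega
      have h1 := ih (par v) (by have := hpd v hv; omega) (hpar v hv).2.2 g
      rw [treeVector_of_pos hpd hv]
      simp only [Pi.add_apply, add_mul, Finset.sum_add_distrib]
      rw [h1, sum_single_mul, cut_mk]
      have := zmod_two_add_self (g (par v))
      linear_combination this
  set A : Finset (Sym2 V) := Finset.univ.filter fun e =>
    e ∈ G.edgeSet ∧ ∀ v, 0 < dep v → e ≠ s(par v, v) with hA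
  have hout : ∀ e : Sym2 V, s(e.out.1, e.out.2) = e := fun e => by
    exact Quot.out_eq e
  set W : Finset V := Finset.univ.filter fun v => 0 < dep v ∧ s(par v, v) ∈ F with hW
  -- As the tree edge above `v` is not a bridge, some walk from `v` to its parent avoids it. The
  -- edge by which that walk leaves the subtree is a chord, since any other tree edge has both ends
  -- inside or both outside.
  have hcross : ∀ v ∈ W, ∃ a ∈ A,
      parity (fun e : Sym2 V => pos e.out.1) (fun e => pos e.out.2) (I v) {a} ≠ 0 := by
    intro v hv
    obtain ⟨hv0, hvF⟩ := (Finset.mem_filter.1 hv).2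
    have hb := (hF _ hvF).2
    rw [SimpleGraph.isBridge_iff, not_not] at hb
    obtain ⟨p⟩ := hb.symm
    have hpv : par v ∉ {w | v ∈ rootPath par dep w} := by
      intro h
      have := dep_of_mem_rootPath hpd h
      have := hpd v hv0
      omega
    obtain ⟨d, _, hd1, hd2⟩ := p.exists_boundary_dart {w | v ∈ rootPath par dep w}
      (self_mem_rootPath hpd hv0) hpv
    have hadj := d.adj
    rw [SimpleGraph.deleteEdges_adj, Set.mem_singleton_iff] at hadj
    have hnot : ∀ x y, v ∈ rootPath par dep x → v ∉ rootPath par dep y →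
        s(x, y) ≠ s(par v, v) → ∀ w, 0 < dep w → s(x, y) ≠ s(par w, w) := by
      intro x y hx hy hne w hw heq
      have hwv : v ≠ w := by rintro rfl; exact hne heq
      have hiff : v ∈ rootPath par dep (par w) ↔ v ∈ rootPath par dep w := by
        rw [rootPath_of_pos hpd hw]
        simp [hwv]
      rw [Sym2.eq_iff] at heq
      rcases heq with ⟨rfl, rfl⟩ | ⟨rfl, rfl⟩
      · exact hy (hiff.1 hx)
      · exact hy (hiff.2 hx)
    refine ⟨s(d.fst, d.snd), Finset.mem_filter.2 ⟨Finset.mem_univ _, hadj.1,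
      hnot _ _ hd1 hd2 hadj.2⟩, ?_⟩
    rw [parity_singleton_ne_zero, hmem, hmem]
    have h := hout s(d.fst, d.snd)
    rw [Sym2.eq_iff] at h
    rcases h with ⟨h1, h2⟩ | ⟨h1, h2⟩
    · rw [h1, h2]
      exact Or.inl ⟨hd1, hd2⟩
    · rw [h1, h2]
      exact Or.inr ⟨hd1, hd2⟩
  obtain ⟨𝓗, hsp, hcovA, hcovW⟩ := exists_sparse_cover (fun e : Sym2 V => pos e.out.1)
    (fun e => pos e.out.2) q hq A ((Finset.card_le_univ _).trans hcard.le)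
    (fun e _ => (hposlt _).trans hV) (fun e _ => (hposlt _).trans hV) I hlam hI W
    ((Finset.card_le_univ _).trans_lt hV) hcross
  -- The fundamental closed vector of a chord: the chord plus both root paths, at most `2 * R + 1`
  -- edges.
  set C : Sym2 V → Sym2 V → ZMod 2 := fun a =>
    Pi.single a 1 + treeVector par dep a.out.1 + treeVector par dep a.out.2 with hC
  set Z : Finset (Sym2 V) → Sym2 V → ZMod 2 := fun H => ∑ a ∈ H, C a
  have hZ : ∀ H e, Z H e = ∑ a ∈ H, C a e := fun H e => Finset.sum_apply e H C
  have hAadj : ∀ a ∈ A, G.Adj a.out.1 a.out.2 := by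
    intro a ha
    have := (Finset.mem_filter.1 ha).2.1
    rwa [← hout a, SimpleGraph.mem_edgeSet] at this
  -- The dictionary: the coordinate of the sum at a tree edge is the parity of `H` on the
  -- corresponding interval. Off the tree, `hZnon` gives the indicator of `H`.
  have hZtree : ∀ H ⊆ A, ∀ v, 0 < dep v → Z H s(par v, v) =
      parity (fun e : Sym2 V => pos e.out.1) (fun e => pos e.out.2) (I v) H := by
    intro H hH v hv
    rw [hZ, parity]
    refine Finset.sum_congr rfl fun a ha => ?_
    have hne := (Finset.mem_filter.1 (hH ha)).2.2 v hv
    have hchi : ∀ w, treeVector par dep w s(par v, v) = chi (I v) (pos w) := by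
      intro w
      rw [treeVector_apply hpd w v hv]
      split_ifs with h
      · rw [chi_of_mem ((hmem v w).2 h)]
      · rw [chi_of_notMem (fun h' => h ((hmem v w).1 h'))]
    simp only [hC, Pi.add_apply]
    rw [Pi.single_eq_of_ne hne.symm, hchi, hchi, zero_add]
  have hZnon : ∀ H, ∀ e, (∀ v, 0 < dep v → e ≠ s(par v, v)) →
      Z H e = if e ∈ H then 1 else 0 := by
    intro H e he
    rw [hZ]
    have : ∀ a ∈ H, C a e = (Pi.single a 1 : Sym2 V → ZMod 2) e := by
      intro a _
      simp only [hC, Pi.add_apply]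
      rw [treeVector_apply_of_ne _ e he hpd, treeVector_apply_of_ne _ e he hpd, add_zero, add_zero]
    rw [Finset.sum_congr rfl this]
    simp [Pi.single_apply]
  refine ⟨𝓗.image Z, ⟨?_, ?_, ?_, ?_, ?_⟩⟩
  · intro Y hY g
    obtain ⟨H, hH, rfl⟩ := Finset.mem_image.1 hY
    simp only [hZ, Finset.sum_mul]
    rw [Finset.sum_comm]
    refine Finset.sum_eq_zero fun a ha => ?_
    have hadj := hAadj a (hsp.subset H hH ha)
    simp only [hC, Pi.add_apply, add_mul, Finset.sum_add_distrib]
    rw [sum_single_mul, hpair _ (hreach _ _ hadj).1, hpair _ (hreach _ _ hadj.symm).1]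
    conv_lhs => rw [← hout a]
    rw [hout a, ← hout a, cut_mk, hout a]
    have e1 := zmod_two_add_self (g a.out.1)
    have e2 := zmod_two_add_self (g a.out.2)
    have e3 := zmod_two_add_self (g u)
    linear_combination e1 + e2 + e3
  · intro Y hY e he
    obtain ⟨H, hH, rfl⟩ := Finset.mem_image.1 hY
    by_cases htree : ∃ v, 0 < dep v ∧ e = s(par v, v)
    · obtain ⟨v, hv, rfl⟩ := htree
      exact (hpar v hv).1
    · push Not at htree
      rw [hZnon H e htree] at he
      have : e ∈ H := by by_contra h; simp [h] at he
      exact (Finset.mem_filter.1 (hsp.subset H hH this)).2.1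
  · intro Y hY
    obtain ⟨H, hH, rfl⟩ := Finset.mem_image.1 hY
    have hsub : (Finset.univ.filter fun e => Z H e ≠ 0) ⊆
        H.biUnion fun a => Finset.univ.filter fun e => C a e ≠ 0 := by
      intro e he
      rw [Finset.mem_filter, hZ] at he
      obtain ⟨a, ha, h⟩ := Finset.exists_ne_zero_of_sum_ne_zero he.2
      exact Finset.mem_biUnion.2 ⟨a, ha, Finset.mem_filter.2 ⟨Finset.mem_univ _, h⟩⟩
    refine (Finset.card_le_card hsub).trans ((Finset.card_biUnion_le_card_mul _ _ (2 * R + 1)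
      fun a ha => ?_).trans (Nat.mul_le_mul_right _ (hsp.card_le H hH)))
    have hadj := hAadj a (hsp.subset H hH ha)
    have hsub' : (Finset.univ.filter fun e => C a e ≠ 0) ⊆ {a} ∪
        (Finset.univ.filter fun e => treeVector par dep a.out.1 e ≠ 0) ∪
        (Finset.univ.filter fun e => treeVector par dep a.out.2 e ≠ 0) := by
      intro e he
      rw [Finset.mem_filter] at he
      simp only [Finset.mem_union, Finset.mem_singleton, Finset.mem_filter, Finset.mem_univ,
        true_and]
      by_contra! hno
      refine he.2 ?_
      simp only [hC, Pi.add_apply]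
      rw [Pi.single_eq_of_ne hno.1.1, hno.1.2, hno.2, add_zero, add_zero]
    have h1 := Finset.card_le_card hsub'
    have h2 := Finset.card_union_le ({a} ∪
        (Finset.univ.filter fun e => treeVector par dep a.out.1 e ≠ 0))
        (Finset.univ.filter fun e => treeVector par dep a.out.2 e ≠ 0)
    have h3 := Finset.card_union_le {a}
        (Finset.univ.filter fun e => treeVector par dep a.out.1 e ≠ 0)
    have h4 := card_support_treeVector_le hpd a.out.1
    have h5 := card_support_treeVector_le hpd a.out.2
    have h6 := (hreach _ _ hadj).2
    have h7 := (hreach _ _ hadj.symm).2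
    rw [Finset.card_singleton] at h3
    omega
  · intro e
    rw [Finset.filter_image]
    refine Finset.card_image_le.trans ?_
    by_cases htree : ∃ v, 0 < dep v ∧ e = s(par v, v)
    · obtain ⟨v, hv, rfl⟩ := htree
      refine le_trans (Finset.card_le_card ?_) (hsp.cut_le (I v) ⟨v, rfl⟩)
      intro H hH
      rw [Finset.mem_filter] at hH ⊢
      rwa [hZtree H (hsp.subset H hH.1) v hv] at hH
    · push Not at htree
      have hle : 9 * q ^ 2 ≤ 351 * q ^ 3 := by
        have : q ^ 2 ≤ q ^ 3 := Nat.pow_le_pow_right hq (by norm_num)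
        omega
      refine le_trans (le_trans (Finset.card_le_card ?_) (hsp.chord_le e)) hle
      intro H hH
      simp only [Finset.mem_filter] at hH ⊢
      refine ⟨hH.1, ?_⟩
      by_contra h
      exact hH.2 (by simp [hZnon H e htree, h])
  · intro e he
    by_cases htree : ∃ v, 0 < dep v ∧ e = s(par v, v)
    · obtain ⟨v, hv, rfl⟩ := htree
      obtain ⟨H, hH, hodd⟩ := hcovW v (Finset.mem_filter.2 ⟨Finset.mem_univ _, hv, he⟩)
      refine ⟨Z H, Finset.mem_image_of_mem _ hH, ?_⟩
      rwa [hZtree H (hsp.subset H hH) v hv]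
    · push Not at htree
      obtain ⟨H, hH, heH⟩ := hcovA e (Finset.mem_filter.2 ⟨Finset.mem_univ _, (hF e he).1, htree⟩)
      refine ⟨Z H, Finset.mem_image_of_mem _ hH, ?_⟩
      rw [hZnon H e htree, if_pos heH]
      exact one_ne_zero

end CycleCover

/-! ### Cycle decomposition and region growing -/

namespace CycleCover

open Finset

theorem sum_cut_edges {V : Type*} {G : SimpleGraph V} (g : V → ZMod 2) {u v : V}
    (p : G.Walk u v) : (p.edges.map (cut g)).sum = g u + g v := by
  induction p with
  | nil => simp [zmod_two_add_self]
  | @cons a b c _ p ih =>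
    rw [SimpleGraph.Walk.edges_cons, List.map_cons, List.sum_cons, ih, cut_mk]
    have := zmod_two_add_self (g b)
    linear_combination this

/-- Every element of the cycle space is an edge-disjoint union of cycles. -/
theorem exists_cycle_decomposition {V : Type*} [DecidableEq V] (G : SimpleGraph V)
    (E : Finset (Sym2 V)) : (∀ e ∈ E, e ∈ G.edgeSet) →
    (∀ g : V → ZMod 2, ∑ e ∈ E, cut g e = 0) →
    ∃ 𝒞 : Finset (Finset (Sym2 V)), (∀ C ∈ 𝒞, IsCycleOf G C ∧ C ⊆ E) ∧
      (𝒞 : Set (Finset (Sym2 V))).PairwiseDisjoint id ∧ ∀ e ∈ E, ∃ C ∈ 𝒞, e ∈ C := by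
  classical
  induction E using Finset.strongInduction with
  | H E ih =>
  intro hE hcl
  rcases E.eq_empty_or_nonempty with rfl | ⟨e, he⟩
  · exact ⟨∅, by simp, by simp, by simp⟩
  set H := SimpleGraph.fromEdgeSet (E : Set (Sym2 V)) with hH
  have hHE : ∀ x y, H.Adj x y → s(x, y) ∈ E := fun x y h => by
    rw [hH, SimpleGraph.fromEdgeSet_adj] at h
    exact Finset.mem_coe.1 h.1
  have hEH : ∀ x y, s(x, y) ∈ E → H.Adj x y := fun x y h => by
    rw [hH, SimpleGraph.fromEdgeSet_adj]
    exact ⟨h, (hE _ h : G.Adj x y).ne⟩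
  -- If `e` were a bridge of `E`, the indicator of one side would pair to `1` with `e` and to `0`
  -- with all other edges, against closedness.
  have hnb : ¬ H.IsBridge e := by
    induction e using Sym2.ind with
    | _ x y =>
    rw [SimpleGraph.isBridge_iff]
    intro hnr
    let g : V → ZMod 2 := fun v => if (H.deleteEdges {s(x, y)}).Reachable x v then 1 else 0
    have hg := hcl g
    rw [← Finset.add_sum_erase _ _ he, Finset.sum_eq_zero, cut_mk] at hg
    · have h1 : g x = 1 := if_pos (SimpleGraph.Reachable.refl x)
      have h2 : g y = 0 := if_neg hnr
      rw [h1, h2] at hg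
      simp at hg
    · intro e' he'
      induction e' using Sym2.ind with
      | _ a b =>
      rw [Finset.mem_erase] at he'
      have hadj : (H.deleteEdges {s(x, y)}).Adj a b := by
        rw [SimpleGraph.deleteEdges_adj]
        exact ⟨hEH a b he'.2, fun h => he'.1 h⟩
      have : g a = g b := by
        have hiff : (H.deleteEdges {s(x, y)}).Reachable x a ↔
            (H.deleteEdges {s(x, y)}).Reachable x b :=
          ⟨fun h => h.trans hadj.reachable, fun h => h.trans hadj.symm.reachable⟩
        simp only [g, hiff]
      rw [cut_mk, this, zmod_two_add_self]
  have heH : e ∈ H.edgeSet := by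
    induction e using Sym2.ind with
    | _ x y => exact hEH x y he
  rw [SimpleGraph.isBridge_iff_forall_cycle_notMem heH] at hnb
  push Not at hnb
  obtain ⟨v, p, hp, hep⟩ := hnb
  have hpE : ∀ e' ∈ p.edges, e' ∈ E := by
    intro e' he'
    have := p.edges_subset_edgeSet he'
    induction e' using Sym2.ind with
    | _ x y => exact hHE x y this
  set C := p.edges.toFinset with hC
  have hCE : C ⊆ E := fun e' he' => hpE e' (List.mem_toFinset.1 he')
  have hCcl : ∀ g : V → ZMod 2, ∑ e ∈ C, cut g e = 0 := by
    intro g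
    rw [hC, List.sum_toFinset _ hp.edges_nodup, sum_cut_edges, zmod_two_add_self]
  have hCcyc : IsCycleOf G C := by
    refine ⟨v, p.transfer G fun e' he' => hE e' (hpE e' he'), hp.transfer _, fun e' => ?_⟩
    rw [SimpleGraph.Walk.edges_transfer, hC, List.mem_toFinset]
  have heC : e ∈ C := List.mem_toFinset.2 hep
  obtain ⟨𝒞, h1, h2, h3⟩ := ih (E \ C) (Finset.sdiff_ssubset hCE ⟨e, heC⟩)
    (fun e' he' => hE e' (Finset.mem_sdiff.1 he').1) (fun g => by
      have := Finset.sum_sdiff (f := cut g) hCE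
      rwa [hCcl, add_zero, hcl] at this)
  refine ⟨insert C 𝒞, ?_, ?_, ?_⟩
  · intro C' hC'
    rcases Finset.mem_insert.1 hC' with rfl | hC'
    · exact ⟨hCcyc, hCE⟩
    · exact ⟨(h1 C' hC').1, (h1 C' hC').2.trans Finset.sdiff_subset⟩
  · rw [Finset.coe_insert]
    refine h2.insert fun C' hC' _ => ?_
    exact (Finset.disjoint_of_subset_left (h1 C' hC').2 Finset.sdiff_disjoint).symm
  · intro e' he'
    by_cases h : e' ∈ C
    · exact ⟨C, Finset.mem_insert_self _ _, h⟩
    · obtain ⟨C', hC', h'⟩ := h3 e' (Finset.mem_sdiff.2 ⟨he', h⟩)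
      exact ⟨C', Finset.mem_insert_of_mem hC', h'⟩

section IsClosedFamily

variable {V : Type*} [Fintype V] {G G' : SimpleGraph V} {ℓ c c' : ℕ} {F F' : Finset (Sym2 V)}
  {𝓩 𝓩' : Finset (Sym2 V → ZMod 2)}

open Classical in
theorem isClosedFamily_empty : IsClosedFamily G ℓ c ∅ ∅ := by
  constructor <;> simp

open Classical in
theorem IsClosedFamily.union (h : IsClosedFamily G ℓ c F 𝓩) (h' : IsClosedFamily G ℓ c' F' 𝓩') :
    IsClosedFamily G ℓ (c + c') (F ∪ F') (𝓩 ∪ 𝓩') := by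
  refine ⟨fun Z hZ => ?_, fun Z hZ => ?_, fun Z hZ => ?_, fun e => ?_, fun e he => ?_⟩
  · exact (Finset.mem_union.1 hZ).elim (h.closed Z) (h'.closed Z)
  · exact (Finset.mem_union.1 hZ).elim (h.mem_edgeSet Z) (h'.mem_edgeSet Z)
  · exact (Finset.mem_union.1 hZ).elim (h.card_le Z) (h'.card_le Z)
  · rw [Finset.filter_union]
    exact (Finset.card_union_le _ _).trans (add_le_add (h.congestion_le e) (h'.congestion_le e))
  · rcases Finset.mem_union.1 he with he | he
    · obtain ⟨Z, hZ, h⟩ := h.covers e he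
      exact ⟨Z, Finset.mem_union_left _ hZ, h⟩
    · obtain ⟨Z, hZ, h⟩ := h'.covers e he
      exact ⟨Z, Finset.mem_union_right _ hZ, h⟩

theorem IsClosedFamily.mono_graph (h : IsClosedFamily G ℓ c F 𝓩) (hG : G ≤ G') :
    IsClosedFamily G' ℓ c F 𝓩 :=
  ⟨h.closed, fun Z hZ e he => SimpleGraph.edgeSet_mono hG (h.mem_edgeSet Z hZ e he), h.card_le,
    h.congestion_le, h.covers⟩

-- Congestions do not add when the host graphs share no edge, so the recursion of the region growing
-- costs nothing.
open Classical in
theorem IsClosedFamily.union_of_disjoint {K : SimpleGraph V} (h : IsClosedFamily G ℓ c F 𝓩)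
    (h' : IsClosedFamily G' ℓ c F' 𝓩') (hG : G ≤ K) (hG' : G' ≤ K)
    (hd : ∀ e, e ∈ G.edgeSet → e ∉ G'.edgeSet) :
    IsClosedFamily K ℓ c (F ∪ F') (𝓩 ∪ 𝓩') := by
  have hu := (h.mono_graph hG).union (h'.mono_graph hG')
  refine ⟨hu.closed, hu.mem_edgeSet, hu.card_le, fun e => ?_, hu.covers⟩
  rw [Finset.filter_union]
  by_cases he : e ∈ G.edgeSet
  · rw [Finset.filter_eq_empty_iff.2 (fun Z hZ hne => hd e he (h'.mem_edgeSet Z hZ e hne)),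
      Finset.union_empty]
    exact h.congestion_le e
  · rw [Finset.filter_eq_empty_iff.2 (fun Z hZ hne => he (h.mem_edgeSet Z hZ e hne)),
      Finset.empty_union]
    exact h'.congestion_le e

end IsClosedFamily

/-- `e` lies on a cycle of `G` of length at most `D`. -/
def OnShortCycle {V : Type*} (G : SimpleGraph V) (D : ℕ) (e : Sym2 V) : Prop :=
  ∃ (v : V) (p : G.Walk v v), p.IsCycle ∧ e ∈ p.edges ∧ p.length ≤ D

theorem exists_walk_of_mem_support {V : Type*} {G : SimpleGraph V} {D : ℕ} {v : V}
    (p : G.Walk v v) (hp : p.length ≤ D) {a b : V} (ha : a ∈ p.support) (hb : b ∈ p.support) :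
    ∃ w : G.Walk a b, w.length ≤ D := by
  classical
  have hb' : b ∈ (p.rotate a ha).support := (p.mem_support_rotate_iff a ha).2 hb
  refine ⟨(p.rotate a ha).takeUntil b hb', ?_⟩
  have := (p.rotate a ha).length_takeUntil_le_length hb'
  rw [SimpleGraph.Walk.length_rotate] at this
  omega

/-- The graph of all edges of `G` with both ends in `S`, on the same vertex set. -/
def restrict {V : Type*} (G : SimpleGraph V) (S : Set V) : SimpleGraph V where
  Adj x y := G.Adj x y ∧ x ∈ S ∧ y ∈ S
  symm := ⟨fun _ _ h => ⟨h.1.symm, h.2.2, h.2.1⟩⟩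
  loopless := ⟨fun _ h => h.1.ne rfl⟩

theorem restrict_le {V : Type*} (G : SimpleGraph V) (S : Set V) : restrict G S ≤ G :=
  fun _ _ h => h.1

theorem mem_edgeSet_restrict_of_mem_edges {V : Type*} {G : SimpleGraph V} {S : Set V} {u v : V}
    (p : G.Walk u v) (h : ∀ x ∈ p.support, x ∈ S) : ∀ e ∈ p.edges, e ∈ (restrict G S).edgeSet := by
  intro e he
  have hG := p.edges_subset_edgeSet he
  induction e using Sym2.ind with
  | _ x y =>
    exact ⟨hG, h _ (p.fst_mem_support_of_mem_edges he), h _ (p.snd_mem_support_of_mem_edges he)⟩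

/-- **Region growing.** At least half of the edges that lie on short cycles can be covered. -/
theorem exists_half_closedFamily {V : Type*} [Fintype V] (D q : ℕ) (hq : 1 ≤ q)
    (hcard : Fintype.card (Sym2 V) < 2 ^ q) (hV : Fintype.card V < 2 ^ q) (n : ℕ) :
    ∀ (G : SimpleGraph V) (F : Finset (Sym2 V)), F.card = n → (∀ e ∈ F, OnShortCycle G D e) →
    ∃ F' ⊆ F, F.card ≤ 2 * F'.card ∧
      ∃ 𝓩, IsClosedFamily G (6 * q * (2 * (D * (2 * q + 2)) + 1)) (351 * q ^ 3) F' 𝓩 := by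
  classical
  induction n using Nat.strong_induction_on with
  | _ n ih =>
  intro G F hn hF
  rcases F.eq_empty_or_nonempty with rfl | ⟨f, hf⟩
  · exact ⟨∅, subset_rfl, by simp, ∅, isClosedFamily_empty⟩
  obtain ⟨x, hx⟩ : ∃ x, x ∈ f := ⟨f.out.1, Sym2.out_fst_mem f⟩
  let B : ℕ → Set V := fun r => {v | ∃ p : G.Walk x v, p.length ≤ r}
  have hBmono : ∀ r r', r ≤ r' → B r ⊆ B r' := fun r r' h v ⟨p, hp⟩ => ⟨p, hp.trans h⟩
  -- A closed walk of length at most `D` that meets a ball lies in the ball with radius larger by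
  -- `D`.
  have hBstep : ∀ r, ∀ e, OnShortCycle G D e → ∀ v (p : G.Walk v v), e ∈ p.edges → p.length ≤ D →
      ∀ a ∈ p.support, a ∈ B r → ∀ b ∈ p.support, b ∈ B (r + D) := by
    rintro r e _ v p _ hpD a ha ⟨w, hw⟩ b hb
    obtain ⟨w', hw'⟩ := exists_walk_of_mem_support p hpD ha hb
    refine ⟨w.append w', ?_⟩
    rw [SimpleGraph.Walk.length_append]
    omega
  let inn : ℕ → Finset (Sym2 V) := fun r => F.filter fun e => ∀ v ∈ e, v ∈ B r
  -- The ball of radius `D` contains the edge `f`, since `f` lies on a short cycle through `x`. Its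
  -- edge count cannot more than double `q` times.
  obtain ⟨j, hj, hgrow⟩ : ∃ j < q, (inn (D + 2 * D * (j + 1))).card ≤
      2 * (inn (D + 2 * D * j)).card := by
    by_contra! hbig
    have hpow : ∀ j ≤ q, 2 ^ j ≤ (inn (D + 2 * D * j)).card := by
      intro j
      induction j with
      | zero =>
        intro _
        refine Finset.card_pos.2 ⟨f, Finset.mem_filter.2 ⟨hf, fun v hv => ?_⟩⟩
        obtain ⟨z, p, hp, hfp, hpD⟩ := hF f hf
        have := hBstep 0 f (hF f hf) z p hfp hpD x
          (SimpleGraph.Walk.mem_support_of_mem_edges hfp hx) ⟨.nil, by simp⟩ v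
          (SimpleGraph.Walk.mem_support_of_mem_edges hfp hv)
        exact hBmono _ _ (by omega) this
      | succ j ihj =>
        intro hj
        have h1 := ihj (by omega)
        have h2 := hbig j (by omega)
        rw [pow_succ]
        omega
    have h1 := hpow q le_rfl
    have h2 : (inn (D + 2 * D * q)).card ≤ Fintype.card (Sym2 V) := Finset.card_le_univ _
    omega
  set r := D + 2 * D * j with hr
  have hr2 : D + 2 * D * (j + 1) = r + D + D := by rw [hr]; ring
  rw [hr2] at hgrow
  set S := B (r + D) with hS
  set Fout := F.filter fun e => OnShortCycle (restrict G Sᶜ) D e with hFout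
  have hxS : x ∈ S := ⟨.nil, by simp⟩
  have hout : ∀ e, OnShortCycle (restrict G Sᶜ) D e → ∀ v ∈ e, v ∉ S := by
    rintro e ⟨z, p, _, hep, _⟩ v hv
    have := p.edges_subset_edgeSet hep
    induction e using Sym2.ind with
    | _ a b =>
      rcases Sym2.mem_iff.1 hv with rfl | rfl
      · exact this.2.1
      · exact this.2.2
  -- The recursion loses at least `f`, so it terminates.
  have hfout : f ∉ Fout := fun h => hout f (Finset.mem_filter.1 h).2 x hx hxS
  have hcardout : Fout.card < n := by
    rw [← hn]
    exact Finset.card_lt_card ((Finset.ssubset_iff_of_subset (Finset.filter_subset _ _)).2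
      ⟨f, hf, hfout⟩)
  obtain ⟨F', hF', hcF', 𝓩', h𝓩'⟩ := ih _ hcardout (restrict G Sᶜ) Fout rfl
    (fun e he => (Finset.mem_filter.1 he).2)
  -- An edge whose short cycle meets `S` lies within radius `r + 2 * D`; all others keep their cycle
  -- outside `S`.
  have hcover : F ⊆ Fout ∪ inn (r + D + D) := by
    intro e he
    rw [Finset.mem_union]
    by_contra! hno
    obtain ⟨z, p, hp, hep, hpD⟩ := hF e he
    have hav : ∀ v ∈ p.support, v ∈ Sᶜ := by
      intro v hv hvS
      refine hno.2 (Finset.mem_filter.2 ⟨he, fun w hw => ?_⟩)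
      exact hBstep (r + D) e (hF e he) z p hep hpD v hv hvS w
        (SimpleGraph.Walk.mem_support_of_mem_edges hep hw)
    refine hno.1 (Finset.mem_filter.2 ⟨he, z,
      p.transfer _ (mem_edgeSet_restrict_of_mem_edges p hav), hp.transfer _, ?_, ?_⟩)
    · rwa [SimpleGraph.Walk.edges_transfer]
    · rwa [SimpleGraph.Walk.length_transfer]
  -- The short cycle of an edge in the core stays in `S`, so the edge is not a bridge of the
  -- restricted graph.
  have hinS : ∀ e ∈ inn r, ∃ (v : V) (p : (restrict G S).Walk v v), p.IsCycle ∧ e ∈ p.edges := by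
    intro e he
    obtain ⟨heF, hein⟩ := Finset.mem_filter.1 he
    obtain ⟨z, p, hp, hep, hpD⟩ := hF e heF
    have hav : ∀ v ∈ p.support, v ∈ S := by
      intro v hv
      have ha : e.out.1 ∈ e := Sym2.out_fst_mem e
      exact hBstep r e (hF e heF) z p hep hpD _
        (SimpleGraph.Walk.mem_support_of_mem_edges hep ha) (hein _ ha) v hv
    refine ⟨z, p.transfer _ (mem_edgeSet_restrict_of_mem_edges p hav), hp.transfer _, ?_⟩
    rwa [SimpleGraph.Walk.edges_transfer]
  have hrad : ∀ v w, (restrict G S).Adj v w →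
      ∃ p : (restrict G S).Walk x v, p.length ≤ D * (2 * q + 2) := by
    rintro v w ⟨_, ⟨p, hp⟩, _⟩
    have hsup : ∀ y ∈ p.support, y ∈ S := by
      intro y hy
      exact ⟨p.takeUntil y hy, (p.length_takeUntil_le_length hy).trans hp⟩
    refine ⟨p.transfer _ (mem_edgeSet_restrict_of_mem_edges p hsup), ?_⟩
    rw [SimpleGraph.Walk.length_transfer]
    refine hp.trans ?_
    calc r + D = D * (2 * j + 2) := by rw [hr]; ring
      _ ≤ D * (2 * q + 2) := Nat.mul_le_mul_left _ (by omega)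
  obtain ⟨𝓩, h𝓩⟩ := exists_closedFamily_of_radius (restrict G S) x (D * (2 * q + 2)) q hq hcard hV
    hrad (inn r) (fun e he => by
      obtain ⟨v, p, hp, hep⟩ := hinS e he
      have hmem := p.edges_subset_edgeSet hep
      refine ⟨hmem, fun hb => ?_⟩
      exact (SimpleGraph.isBridge_iff_forall_cycle_notMem hmem).1 hb p hp hep)
  refine ⟨inn r ∪ F', Finset.union_subset (Finset.filter_subset _ _)
    (hF'.trans (Finset.filter_subset _ _)), ?_, 𝓩 ∪ 𝓩',
    h𝓩.union_of_disjoint h𝓩' (restrict_le _ _) (restrict_le _ _) ?_⟩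
  · have hdis : Disjoint (inn r) F' := by
      rw [Finset.disjoint_left]
      intro e he he'
      have ha : e.out.1 ∈ e := Sym2.out_fst_mem e
      exact hout e (Finset.mem_filter.1 (hF' he')).2 _ ha
        (hBmono _ _ (by omega) ((Finset.mem_filter.1 he).2 _ ha))
    rw [Finset.card_union_of_disjoint hdis]
    have h1 := Finset.card_le_card hcover
    have h2 := Finset.card_union_le Fout (inn (r + D + D))
    omega
  · intro e he he'
    induction e using Sym2.ind with
    | _ a b => exact he'.2.1 he.2.1

/-- Halving `j` times, always in the full graph `G`, so congestion adds over the rounds. -/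
theorem exists_closedFamily_aux {V : Type*} [Fintype V] (G : SimpleGraph V) (D q : ℕ) (hq : 1 ≤ q)
    (hcard : Fintype.card (Sym2 V) < 2 ^ q) (hV : Fintype.card V < 2 ^ q) (j : ℕ) :
    ∀ F : Finset (Sym2 V), F.card < 2 ^ j → (∀ e ∈ F, OnShortCycle G D e) →
    ∃ 𝓩, IsClosedFamily G (6 * q * (2 * (D * (2 * q + 2)) + 1)) (j * (351 * q ^ 3)) F 𝓩 := by
  classical
  induction j with
  | zero =>
    intro F hF _
    have : F = ∅ := Finset.card_eq_zero.1 (by simpa using hF)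
    subst this
    exact ⟨∅, isClosedFamily_empty⟩
  | succ j ih =>
    intro F hj hF
    obtain ⟨F', hF', hc, 𝓩, h𝓩⟩ := exists_half_closedFamily D q hq hcard hV _ G F rfl hF
    have := Finset.card_sdiff_add_card_eq_card hF'
    obtain ⟨𝓩', h𝓩'⟩ := ih (F \ F') (by rw [pow_succ] at hj; omega)
      (fun e he => hF e (Finset.mem_sdiff.1 he).1)
    refine ⟨𝓩' ∪ 𝓩, ?_⟩
    have h := h𝓩'.union h𝓩
    rwa [Finset.sdiff_union_of_subset hF', ← add_one_mul] at h

/-- All edges on cycles of length at most `D` can be covered by elements of the cycle space of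
length `O(D log² n)`. -/
theorem exists_closedFamily {V : Type*} [Fintype V] (G : SimpleGraph V) (D q : ℕ) (hq : 1 ≤ q)
    (hD : 1 ≤ D) (hcard : Fintype.card (Sym2 V) < 2 ^ q) (hV : Fintype.card V < 2 ^ q)
    (F : Finset (Sym2 V)) (hF : ∀ e ∈ F, OnShortCycle G D e) :
    ∃ 𝓩, IsClosedFamily G (54 * q ^ 2 * D) (351 * q ^ 4) F 𝓩 := by
  obtain ⟨𝓩, h⟩ := exists_closedFamily_aux G D q hq hcard hV q F
    ((Finset.card_le_univ F).trans_lt hcard) hF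
  refine ⟨𝓩, h.closed, h.mem_edgeSet, fun Z hZ => (h.card_le Z hZ).trans ?_,
    fun e => (h.congestion_le e).trans (le_of_eq (by ring)), h.covers⟩
  have h1 : D ≤ q * D := Nat.le_mul_of_pos_left _ hq
  have h2 : 2 * (D * (2 * q + 2)) + 1 ≤ 9 * (q * D) := by nlinarith
  calc 6 * q * (2 * (D * (2 * q + 2)) + 1) ≤ 6 * q * (9 * (q * D)) := Nat.mul_le_mul_left _ h2
    _ = 54 * q ^ 2 * D := by ring

end CycleCover

/-! ### Combining the length scales -/

namespace CycleCover

open Finset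

/-- The cycles cut out of one `Z` are edge-disjoint, so each `Z` puts at most one of them on any
edge of its support. -/
theorem exists_cycles_of_isClosedFamily {V : Type*} [Fintype V] {G : SimpleGraph V} {ℓ c : ℕ}
    {F : Finset (Sym2 V)} {𝓩 : Finset (Sym2 V → ZMod 2)} (h : IsClosedFamily G ℓ c F 𝓩) :
    ∃ 𝒞 : Finset (Finset (Sym2 V)), (∀ C ∈ 𝒞, IsCycleOf G C ∧ C.card ≤ ℓ) ∧
      (∀ e, congestion 𝒞 e ≤ c) ∧ ∀ e ∈ F, ∃ C ∈ 𝒞, e ∈ C := by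
  classical
  have hdec : ∀ Z ∈ 𝓩, ∃ 𝒞 : Finset (Finset (Sym2 V)),
      (∀ C ∈ 𝒞, IsCycleOf G C ∧ C ⊆ Finset.univ.filter fun e => Z e ≠ 0) ∧
      (𝒞 : Set (Finset (Sym2 V))).PairwiseDisjoint id ∧
      ∀ e ∈ Finset.univ.filter (fun e => Z e ≠ 0), ∃ C ∈ 𝒞, e ∈ C := by
    intro Z hZ
    refine exists_cycle_decomposition G _
      (fun e he => h.mem_edgeSet Z hZ e (Finset.mem_filter.1 he).2) fun g => ?_
    rw [Finset.sum_filter]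
    refine Eq.trans ?_ (h.closed Z hZ g)
    refine Finset.sum_congr rfl fun e _ => ?_
    generalize Z e = x
    generalize cut g e = y
    revert x y
    decide
  choose! 𝒟 h1 h2 h3 using hdec
  refine ⟨𝓩.biUnion 𝒟, fun C hC => ?_, fun e => ?_, fun e he => ?_⟩
  · obtain ⟨Z, hZ, hC⟩ := Finset.mem_biUnion.1 hC
    exact ⟨(h1 Z hZ C hC).1, (Finset.card_le_card (h1 Z hZ C hC).2).trans (by
      convert h.card_le Z hZ)⟩
  · have hsub : (𝓩.biUnion 𝒟).filter (fun C => e ∈ C) ⊆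
        (𝓩.filter fun Z => Z e ≠ 0).biUnion fun Z => (𝒟 Z).filter fun C => e ∈ C := by
      intro C hC
      simp only [Finset.mem_filter, Finset.mem_biUnion] at hC ⊢
      obtain ⟨⟨Z, hZ, hCZ⟩, heC⟩ := hC
      have := (h1 Z hZ C hCZ).2 heC
      exact ⟨Z, ⟨hZ, (Finset.mem_filter.1 this).2⟩, hCZ, heC⟩
    have hone : ∀ Z ∈ 𝓩.filter (fun Z => Z e ≠ 0), ((𝒟 Z).filter fun C => e ∈ C).card ≤ 1 := by
      intro Z hZ
      refine Finset.card_le_one.2 fun C hC C' hC' => ?_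
      simp only [Finset.mem_filter] at hC hC'
      by_contra hne
      exact Finset.disjoint_left.1 (h2 Z (Finset.mem_filter.1 hZ).1 hC.1 hC'.1 hne) hC.2 hC'.2
    have h4 := (Finset.card_le_card hsub).trans (Finset.card_biUnion_le_card_mul _ _ 1 hone)
    have h5 := h.congestion_le e
    have h6 : congestion (𝓩.biUnion 𝒟) e = ((𝓩.biUnion 𝒟).filter (fun C => e ∈ C)).card := by
      rw [congestion]
    rw [h6]
    refine h4.trans ?_
    rw [mul_one]
    convert h5
  · obtain ⟨Z, hZ, hne⟩ := h.covers e he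
    obtain ⟨C, hC, heC⟩ := h3 Z hZ e (Finset.mem_filter.2 ⟨Finset.mem_univ _, hne⟩)
    exact ⟨C, Finset.mem_biUnion.2 ⟨Z, hZ, hC⟩, heC⟩

theorem congestion_biUnion_le {V κ : Type*} [DecidableEq (Finset (Sym2 V))] (K : Finset κ)
    (𝒞 : κ → Finset (Finset (Sym2 V)))
    (c : ℕ) (e : Sym2 V) (h : ∀ i ∈ K, congestion (𝒞 i) e ≤ c) :
    congestion (K.biUnion 𝒞) e ≤ K.card * c := by
  classical
  rw [congestion, Finset.filter_biUnion]
  exact Finset.card_biUnion_le_card_mul _ _ _ h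

theorem onShortCycle_of_shortestCycleLength_le {V : Type*} {G : SimpleGraph V}
    (hG : Bridgeless G) {e : Sym2 V} (he : e ∈ G.edgeSet) {D : ℕ}
    (hD : shortestCycleLength G e ≤ D) : OnShortCycle G D e := by
  classical
  obtain ⟨C, ⟨v, p, hp, hpC⟩, heC, hcard⟩ := exists_shortest_cycle hG he
  refine ⟨v, p, hp, (hpC e).1 heC, ?_⟩
  have : C = p.edges.toFinset := by
    ext e'
    rw [List.mem_toFinset, hpC]
  rw [this, List.toFinset_card_of_nodup hp.edges_nodup, SimpleGraph.Walk.length_edges] at hcard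
  omega

/-- The cycle cover theorem with explicit bounds in terms of a bound `2 ^ q` on the size of `G`. -/
theorem exists_cycleCover_of_card_lt {V : Type*} [Fintype V] (G : SimpleGraph V)
    (hG : Bridgeless G) (q : ℕ) (hq : 1 ≤ q) (hcard : Fintype.card (Sym2 V) < 2 ^ q)
    (hV : Fintype.card V < 2 ^ q) :
    ∃ 𝒞 : Finset (Finset (Sym2 V)), (∀ C ∈ 𝒞, IsCycleOf G C) ∧
      (∀ C ∈ 𝒞, C.card ≤ 108 * q ^ 2 * optCycleLength G) ∧
      (∀ e, congestion 𝒞 e ≤ 351 * q ^ 5) ∧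
      ∀ e ∈ G.edgeSet, ∃ C ∈ 𝒞, e ∈ C ∧ C.card ≤ 108 * q ^ 2 * shortestCycleLength G e := by
  classical
  let F : ℕ → Finset (Sym2 V) := fun i => Finset.univ.filter fun e =>
    e ∈ G.edgeSet ∧ Nat.log 2 (shortestCycleLength G e) = i
  have hpos : ∀ e ∈ G.edgeSet, shortestCycleLength G e ≠ 0 := by
    intro e he h0
    obtain ⟨C, _, heC, hcard⟩ := exists_shortest_cycle hG he
    rw [h0, Finset.card_eq_zero] at hcard
    simp [hcard] at heC
  have hlt : ∀ e ∈ G.edgeSet, shortestCycleLength G e < 2 ^ q := by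
    intro e he
    obtain ⟨C, _, _, hC⟩ := exists_shortest_cycle hG he
    rw [← hC]
    exact (Finset.card_le_univ C).trans_lt hcard
  have hopt : ∀ e ∈ G.edgeSet, shortestCycleLength G e ≤ optCycleLength G := fun e he =>
    le_ciSup (f := fun e : G.edgeSet => shortestCycleLength G e.1)
      (Set.finite_range _).bddAbove ⟨e, he⟩
  have hlow : ∀ i, ∀ e ∈ F i, 2 ^ i ≤ shortestCycleLength G e := by
    intro i e he
    obtain ⟨_, heG, rfl⟩ := Finset.mem_filter.1 he
    exact Nat.pow_log_le_self 2 (hpos e heG)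
  -- An empty class receives no cycles. Thus any cycle of scale `i` comes with an edge of that
  -- class, whence `2 ^ i` is at most `optCycleLength G`.
  have hscale : ∀ i, ∃ 𝒞 : Finset (Finset (Sym2 V)),
      (∀ C ∈ 𝒞, IsCycleOf G C ∧ C.card ≤ 54 * q ^ 2 * 2 ^ (i + 1) ∧ (F i).Nonempty) ∧
      (∀ e, congestion 𝒞 e ≤ 351 * q ^ 4) ∧ ∀ e ∈ F i, ∃ C ∈ 𝒞, e ∈ C := by
    intro i
    rcases (F i).eq_empty_or_nonempty with h | h
    · exact ⟨∅, by simp, by simp [congestion], by simp [h]⟩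
    obtain ⟨𝓩, h𝓩⟩ := exists_closedFamily G (2 ^ (i + 1)) q hq Nat.one_le_two_pow hcard hV (F i)
      (fun e he => by
        obtain ⟨_, heG, rfl⟩ := Finset.mem_filter.1 he
        exact onShortCycle_of_shortestCycleLength_le hG heG
          (Nat.lt_pow_succ_log_self (by norm_num) _).le)
    obtain ⟨𝒞, h1, h2, h3⟩ := exists_cycles_of_isClosedFamily h𝓩
    exact ⟨𝒞, fun C hC => ⟨(h1 C hC).1, (h1 C hC).2, h⟩, h2, h3⟩
  choose 𝒞 h1 h2 h3 using hscale
  have hbound : ∀ i, ∀ C ∈ 𝒞 i, ∀ l, 2 ^ i ≤ l → C.card ≤ 108 * q ^ 2 * l := by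
    intro i C hC l hl
    calc C.card ≤ 54 * q ^ 2 * 2 ^ (i + 1) := (h1 i C hC).2.1
      _ = 108 * q ^ 2 * 2 ^ i := by ring
      _ ≤ 108 * q ^ 2 * l := Nat.mul_le_mul_left _ hl
  refine ⟨(Finset.range q).biUnion 𝒞, fun C hC => ?_, fun C hC => ?_, fun e => ?_, fun e he => ?_⟩
  · obtain ⟨i, _, hC⟩ := Finset.mem_biUnion.1 hC
    exact (h1 i C hC).1
  · obtain ⟨i, _, hC⟩ := Finset.mem_biUnion.1 hC
    obtain ⟨e, he⟩ := (h1 i C hC).2.2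
    exact hbound i C hC _ ((hlow i e he).trans (hopt e (Finset.mem_filter.1 he).2.1))
  · refine (congestion_biUnion_le _ 𝒞 (351 * q ^ 4) e fun i _ => h2 i e).trans (le_of_eq ?_)
    rw [Finset.card_range]
    ring
  · have heF : e ∈ F (Nat.log 2 (shortestCycleLength G e)) :=
      Finset.mem_filter.2 ⟨Finset.mem_univ _, he, rfl⟩
    obtain ⟨C, hC, heC⟩ := h3 _ e heF
    exact ⟨C, Finset.mem_biUnion.2
      ⟨_, Finset.mem_range.2 (Nat.log_lt_of_lt_pow (hpos e he) (hlt e he)), hC⟩, heC,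
      hbound _ C hC _ (hlow _ e heF)⟩

/-- Both summands are at most `Real.log n / Real.log 2`, and `2 / Real.log 2 < 3`. -/
theorem log_two_add_one_le {n : ℕ} (hn : 2 ≤ n) : ((Nat.log 2 n + 1 : ℕ) : ℝ) ≤ 3 * Real.log n := by
  have h1 : (Nat.log 2 n : ℝ) * Real.log 2 ≤ Real.log n := by
    rw [← Real.log_pow]
    refine Real.log_le_log (by positivity) ?_
    exact_mod_cast Nat.pow_log_le_self 2 (by omega)
  have h2 : Real.log 2 ≤ Real.log n := Real.log_le_log (by norm_num) (by exact_mod_cast hn)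
  have h3 := Real.log_two_gt_d9
  have h4 : (0 : ℝ) ≤ Nat.log 2 n := Nat.cast_nonneg _
  push_cast
  nlinarith

end CycleCover
theorem theorem2 :
    ∃ (K : ℝ) (k : ℕ), 0 < K ∧ ∀ (V : Type*) [Fintype V] (G : SimpleGraph V),
      CycleCover.Bridgeless G →
      ∃ 𝒞 : Finset (Finset (Sym2 V)),
        CycleCover.IsCycleCover G
          (K * Real.log (Fintype.card V) ^ k * CycleCover.optCycleLength G)
          (K * Real.log (Fintype.card V) ^ k) 𝒞 ∧
        ∀ e ∈ G.edgeSet, ∃ C ∈ 𝒞, e ∈ C ∧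
          (C.card : ℝ) ≤
            K * Real.log (Fintype.card V) ^ k * CycleCover.shortestCycleLength G e := by
  -- The size exponent is `q = 2 * m` with `m = Nat.log 2 n + 1`, as there are at most `n ^ 2`
  -- unordered pairs. Then `q ≤ 6 * Real.log n`, and the largest bound, the congestion `351 * q ^
  -- 5`, fixes both constants.
  refine ⟨351 * 6 ^ 5, 5, by norm_num, fun V _ G hG => ?_⟩
  classical
  rcases G.edgeSet.eq_empty_or_nonempty with hE | ⟨e₀, he₀⟩
  · exact ⟨∅, ⟨by simp, by simp, by simp [hE], by simp [hE]⟩, by simp [hE]⟩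
  have hn : 2 ≤ Fintype.card V := by
    induction e₀ using Sym2.ind with
    | _ x y => exact Fintype.one_lt_card_iff.2 ⟨x, y, (he₀ : G.Adj x y).ne⟩
  set n := Fintype.card V with hndef
  set m := Nat.log 2 n + 1 with hm
  have hnm : n < 2 ^ m := Nat.lt_pow_succ_log_self (by norm_num) n
  have hcard : Fintype.card (Sym2 V) < 2 ^ (2 * m) := by
    have h1 := Fintype.card_le_of_surjective _ (Sym2.mk_surjective (α := V))
    rw [Fintype.card_prod, ← hndef] at h1
    calc Fintype.card (Sym2 V) ≤ n * n := h1
      _ < 2 ^ m * 2 ^ m := Nat.mul_self_lt_mul_self hnm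
      _ = 2 ^ (2 * m) := by rw [two_mul]; exact (pow_add 2 m m).symm
  obtain ⟨𝒞, h1, h2, h3, h4⟩ := CycleCover.exists_cycleCover_of_card_lt G hG (2 * m) (by omega)
    hcard (hnm.trans_le (Nat.pow_le_pow_right (by norm_num) (by omega)))
  have hq : ((2 * m : ℕ) : ℝ) ≤ 6 * Real.log n := by
    have := CycleCover.log_two_add_one_le hn
    rw [← hm] at this
    push_cast
    linarith
  have h5 : (351 : ℝ) * ((2 * m : ℕ) : ℝ) ^ 5 ≤ 351 * 6 ^ 5 * Real.log n ^ 5 := by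
    rw [mul_assoc, ← mul_pow]
    gcongr
  have h6 : (108 : ℝ) * ((2 * m : ℕ) : ℝ) ^ 2 ≤ 351 * 6 ^ 5 * Real.log n ^ 5 := by
    refine le_trans ?_ h5
    have hge : (1 : ℝ) ≤ ((2 * m : ℕ) : ℝ) := by exact_mod_cast (by omega : 1 ≤ 2 * m)
    have := pow_le_pow_right₀ hge (by norm_num : 2 ≤ 5)
    have := pow_nonneg (zero_le_one.trans hge) 5
    linarith
  have h7 : ∀ (C : Finset (Sym2 V)) (l : ℕ), C.card ≤ 108 * (2 * m) ^ 2 * l →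
      (C.card : ℝ) ≤ 351 * 6 ^ 5 * Real.log n ^ 5 * l := by
    intro C l h
    have h' : (C.card : ℝ) ≤ 108 * ((2 * m : ℕ) : ℝ) ^ 2 * l := by exact_mod_cast h
    exact h'.trans (mul_le_mul_of_nonneg_right h6 (Nat.cast_nonneg l))
  refine ⟨𝒞, ⟨h1, fun C hC => h7 C _ (h2 C hC), fun e he => ?_, fun e _ => ?_⟩, fun e he => ?_⟩
  · obtain ⟨C, hC, heC, _⟩ := h4 e he
    exact ⟨C, hC, heC⟩
  · refine le_trans ?_ h5
    exact_mod_cast h3 e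
  · obtain ⟨C, hC, heC, hle⟩ := h4 e he
    exact ⟨C, hC, heC, h7 C _ hle⟩
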